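/- **Setting.** The Baire space $\mathscr N$ is the set of sequences $\beta=(\beta(n))_{n\in\mathbb N}$ of positive integers, with the metric $\mathsf d(\beta,\eta)=0$ if $\beta=\eta$ and $\mathsf d(\beta,\eta)=2^{-\min\{n\,:\,\beta(n)\neq\eta(n)\}}$ otherwise. For $\beta\in\mathscr N$ put $\boxtimes\beta(n)=\prod_{j<n}(\beta(j)+1)$ (so $\boxtimes\beta(0)=1$), and let $\mathfrak u(\beta)$ be the C*-inductive limit of the full matrix algebras $\mathfrak M(\boxtimes\beta(n))$ of size $\boxtimes\beta(n)\times\boxtimes\beta(n)$ under the unital diagonal embeddings $A\mapsto\mathrm{diag}(A,\dots,A)$. Let $\mathfrak A$ be a C*-inductive limit of a sequence $\mathcal I=(\mathfrak A_n)_{n\in\mathbb N}$ of finite-dimensional C*-algebras with injective unital connecting *-homomorphisms and $\mathfrak A_0=\mathbb C$, let $\mu$ be a faithful tracial state on $\mathfrak A$, and let $\vartheta:\mathbb N\to(0,\infty)$ tend to $0$. The associated Lip-norm on self-adjoint elements is $$\mathsf L_{\mathcal I,\mu}^{\vartheta}(a)=\sup_{n\in\mathbb N}\frac{\|a-\mathbb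 E_n(a)\|}{\vartheta(n)}\in[0,\infty],$$ where $\mathbb E_n$ is the unique $\mu$-preserving conditional expectation of $\mathfrak A$ onto the image of $\mathfrak A_n$. For $k>0$, let $\mathcal{UHF}^k$ be the class of pairs $(\mathfrak A,\mathsf L)$ where $\mathfrak A$ is infinite dimensional and is the C*-inductive limit of a sequence $\mathcal I=(\mathfrak A_n)_{n\in\mathbb N}$ of full matrix algebras with injective unital connecting *-homomorphisms and $\mathfrak A_0=\mathbb C$, and $\mathsf L=\mathsf L_{\mathcal I,\mu}^{\vartheta}$ for a faithful tracial state $\mu$ on $\mathfrak A$ and $\vartheta(n)=(\dim\mathfrak A_n)^{-k}$. A $(2,0)$-quasi-Leibniz quantum compact metric space is a pair $(\mathfrak A,\mathsf L)$ of a unital C*-algebra and a lower semicontinuous seminorm $\mathsf L$ with dense domain in the self-adjoint part (extended by $\infty$), with $\mathsf L(a)=0\iff a\in\mathbb R1$, with $\max\{\mathsf L(\tfrac{ab+ba}{2}),\mathsf L(\tfrac{ab-ba}{2i})\}\le 2(\|a\|\mathsf L(b)+\|b\|\mathsf L(a))$ on the domain, and such that $\mathsf{mk}_{\mathsf L}(\varphi,\psi)=\sup\{|\varphi(a)-\psi(a)|:\mathsf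 L(a)\le1\}$ metrizes the weak* topology of the state space. The quantum propinquity $\mathsf\Lambda=\mathsf\Lambda_{2,0}$ is the largest pseudo-distance on the class of these spaces that is bounded above by the length of every bridge, i.e. the infimum over finite chains of bridges between such spaces of the sum of their lengths. Here a bridge from $\mathfrak A$ to $\mathfrak B$ consists of a unital C*-algebra $\mathfrak D$, unital *-monomorphisms $\pi_{\mathfrak A},\pi_{\mathfrak B}$ of $\mathfrak A,\mathfrak B$ into $\mathfrak D$, and $\omega\in\mathfrak D$ whose $1$-level set $\mathscr S_1=\{\varphi\in\mathscr S(\mathfrak D):\varphi(1-\omega^*\omega)=\varphi(1-\omega\omega^*)=0\}$ is not empty. Its length is the maximum of the Hausdorff distance from $\mathscr S(\mathfrak A)$ to $\pi_{\mathfrak A}^*(\mathscr S_1)$ for $\mathsf{mk}_{\mathsf L_{\mathfrak A}}$, the Hausdorff distance from $\mathscr S(\mathfrak B)$ to $\pi_{\mathfrak B}^*(\mathscr S_1)$ for $\mathsf{mk}_{\mathsf L_{\mathfrak B}}$, and the Hausdorff distance between $\{\mathsf L_{\mathfrak A}\le1\}$ and $\{\mathsf L_{\mathfrak B}\le1\}$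 for the seminorm $(a,b)\mapsto\|\pi_{\mathfrak A}(a)\omega-\omega\pi_{\mathfrak B}(b)\|$ on $\mathfrak A\oplus\mathfrak B$. **Theorem.** Let $k\in(0,\infty)$. 1. For every $\beta\in\mathscr N$, the algebra $\mathfrak u(\beta)$ has exactly one tracial state $\mu_\beta$, this state is faithful, and for every $n$ there is exactly one $\mu_\beta$-preserving conditional expectation of $\mathfrak u(\beta)$ onto the image of $\mathfrak M(\boxtimes\beta(n))$. 2. Give $\mathfrak u(\beta)$ the Lip-norm of its defining sequence, of $\mu_\beta$ and of $\vartheta(n)=\dim(\mathfrak M(\boxtimes\beta(n)))^{-k}=\boxtimes\beta(n)^{-2k}$. The resulting pair $\mathfrak{uhf}_{\beta}$ is a $(2,0)$-quasi-Leibniz quantum compact metric space that belongs to $\mathcal{UHF}^k$; for all $\beta,\eta\in\mathscr N$, $$\mathsf\Lambda(\mathfrak{uhf}_{\beta},\mathfrak{uhf}_{\eta})\le 2\,\mathsf d(\beta,\eta)^k;$$ and every member of $\mathcal{UHF}^k$ is isometrically isomorphic to some $\mathfrak{uhf}_{\beta}$ (there is a *-isomorphism intertwining the Lip-norms). That is,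 $\beta\mapsto\mathfrak{uhf}_\beta$ is a $(2,k)$-Hölder surjection of $\mathscr N$ onto $\mathcal{UHF}^k$. 3. The same holds for $\vartheta(n)=\boxtimes\beta(n)^{-k}$, with $\mathcal{UHF}^{k/2}$ in place of $\mathcal{UHF}^{k}$ and the same Hölder estimate $2\,\mathsf d(\beta,\eta)^k$. -/

import Mathlib

open scoped NNReal ENNReal Topology Matrix.Norms.L2Operator ComplexOrder

noncomputable section

namespace QuantumMetric

/-! ### States and traces -/

section States

variable {A B : Type} [CStarAlgebra A] [CStarAlgebra B]

/-- A state: a positive linear functional taking the value `1` at the unit. -/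
def IsState (φ : A →ₗ[ℂ] ℂ) : Prop :=
  φ 1 = 1 ∧ ∀ a, 0 ≤ φ (star a * a)

/-- A tracial state. -/
def IsTracialState (μ : A →ₗ[ℂ] ℂ) : Prop :=
  IsState μ ∧ ∀ a b, μ (a * b) = μ (b * a)

/-- Faithfulness of a positive functional. -/
def IsFaithful (μ : A →ₗ[ℂ] ℂ) : Prop :=
  ∀ a, μ (star a * a) = 0 → a = 0

variable (A) in
/-- The state space. -/
def State : Type := {φ : A →ₗ[ℂ] ℂ // IsState φ}

/-- The value of a state at an element. -/
instance : CoeFun (State A) fun _ => A → ℂ := ⟨fun φ a => φ.1 a⟩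

/-- The weak* topology of the state space: the topology of pointwise convergence. -/
instance : TopologicalSpace (State A) :=
  TopologicalSpace.induced (fun φ => (φ : A → ℂ)) inferInstance

/-- The dual map `φ ↦ φ ∘ π` of a unital *-homomorphism `π`. -/
def State.pullback (π : A →⋆ₐ[ℂ] B) (φ : State B) : State A :=
  ⟨φ.1 ∘ₗ π.toAlgHom.toLinearMap, by
    refine ⟨?_, fun a => ?_⟩
    · have h := φ.2.1
      simpa using h
    · have h := φ.2.2 (π a)
      rw [← map_star, ← map_mul] at h
      exact h⟩

end States

/-! ### Quasi-Leibniz quantum compact metric spaces -/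

/-- A unital C*-algebra with a `[0, ∞]`-valued function on its self-adjoint part (a seminorm
defined on a subspace being extended by `∞` off its domain). -/
structure LipPair where
  carrier : Type
  [cstar : CStarAlgebra carrier]
  L : selfAdjoint carrier → ℝ≥0∞

attribute [instance] LipPair.cstar

section Lip

variable {A : Type} [CStarAlgebra A]

/-- The Jordan product `(ab + ba) / 2`. -/
def jordanProduct (a b : selfAdjoint A) : selfAdjoint A :=
  ⟨(1 / 2 : ℂ) • ((a : A) * b + b * a), by
    rw [selfAdjoint.mem_iff, star_smul, star_add, star_mul, star_mul, selfAdjoint.star_val_eq,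
      selfAdjoint.star_val_eq, add_comm]
    simp⟩

/-- The Lie product `(ab - ba) / 2i`. -/
def lieProduct (a b : selfAdjoint A) : selfAdjoint A :=
  ⟨(1 / (2 * Complex.I) : ℂ) • ((a : A) * b - b * a), by
    rw [selfAdjoint.mem_iff, star_smul, star_sub, star_mul, star_mul, selfAdjoint.star_val_eq,
      selfAdjoint.star_val_eq, ← neg_sub, smul_neg, ← neg_smul]
    simp⟩

/-- The Monge–Kantorovich metric on the state space. -/
def mongeKantorovich (L : selfAdjoint A → ℝ≥0∞) (φ ψ : State A) : ℝ≥0∞ :=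
  ⨆ (a : selfAdjoint A) (_ : L a ≤ 1), ‖φ a - ψ a‖ₑ

/-- `d` is finite and its balls generate the weak* topology of the state space. -/
def MetrizesWeakStar (d : State A → State A → ℝ≥0∞) : Prop :=
  (∀ φ ψ, d φ ψ ≠ ⊤) ∧
  ∀ U : Set (State A), IsOpen U ↔ ∀ φ ∈ U, ∃ ε : ℝ≥0∞, 0 < ε ∧ ∀ ψ, d φ ψ < ε → ψ ∈ U

end Lip

/-- `(C, D)`-quasi-Leibniz quantum compact metric spaces. The domain of the seminorm is
`{a | L a < ∞}`; the quasi-Leibniz inequality makes it a Jordan–Lie subalgebra. -/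
structure IsQuasiLeibnizQCMS (C D : ℝ≥0) (X : LipPair) : Prop where
  add_le : ∀ a b, X.L (a + b) ≤ X.L a + X.L b
  smul_eq : ∀ (t : ℝ) a, X.L (t • a) = ‖t‖ₑ * X.L a
  dense_domain : Dense {a | X.L a < ⊤}
  eq_zero_iff : ∀ a, X.L a = 0 ↔ ∃ t : ℝ, (a : X.carrier) = (t : ℂ) • (1 : X.carrier)
  quasi_leibniz : ∀ a b, X.L a < ⊤ → X.L b < ⊤ →
    max (X.L (jordanProduct a b)) (X.L (lieProduct a b)) ≤
      C * (‖(a : X.carrier)‖ₑ * X.L b + ‖(b : X.carrier)‖ₑ * X.L a) + D * (X.L a * X.L b)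
  metrizes : MetrizesWeakStar (mongeKantorovich X.L)
  lowerSemicontinuous : LowerSemicontinuous X.L

/-- Isometric isomorphism: a *-isomorphism intertwining the Lip-norms. -/
def IsometricallyIsomorphic (X Y : LipPair) : Prop :=
  ∃ π : X.carrier ≃⋆ₐ[ℂ] Y.carrier,
    ∀ a : selfAdjoint X.carrier, Y.L ⟨π a, IsSelfAdjoint.map a.2 π⟩ = X.L a

/-! ### Bridges and the quantum propinquity -/

/-- The Hausdorff distance between two sets for a (pseudo)distance `d`. -/
def hausdorff {T : Type} (d : T → T → ℝ≥0∞) (S S' : Set T) : ℝ≥0∞ :=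
  max (⨆ x ∈ S, ⨅ y ∈ S', d x y) (⨆ y ∈ S', ⨅ x ∈ S, d x y)

/-- The `1`-level set of an element. -/
def levelSet {D : Type} [CStarAlgebra D] (ω : D) : Set (State D) :=
  {φ | φ (1 - star ω * ω) = 0 ∧ φ (1 - ω * star ω) = 0}

/-- A bridge between two unital C*-algebras. -/
structure Bridge (A B : Type) [CStarAlgebra A] [CStarAlgebra B] where
  D : Type
  [cstar : CStarAlgebra D]
  left : A →⋆ₐ[ℂ] D
  right : B →⋆ₐ[ℂ] D
  left_injective : Function.Injective left
  right_injective : Function.Injective right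
  pivot : D
  levelSet_nonempty : (levelSet pivot).Nonempty

attribute [instance] Bridge.cstar

section Bridge

variable {X Y : LipPair} (γ : Bridge X.carrier Y.carrier)

/-- The height of a bridge. -/
def Bridge.height : ℝ≥0∞ :=
  max
    (hausdorff (mongeKantorovich X.L) Set.univ (State.pullback γ.left '' levelSet γ.pivot))
    (hausdorff (mongeKantorovich Y.L) Set.univ (State.pullback γ.right '' levelSet γ.pivot))

/-- The bridge seminorm on `A ⊕ B`. -/
def Bridge.seminorm (p : X.carrier × Y.carrier) : ℝ≥0∞ :=
  ‖γ.left p.1 * γ.pivot - γ.pivot * γ.right p.2‖ₑ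

/-- The reach of a bridge: the Hausdorff distance, for the bridge seminorm, between the Lip-norm
unit balls seen in `A ⊕ {0}` and `{0} ⊕ B`. -/
def Bridge.reach : ℝ≥0∞ :=
  hausdorff (fun p q => γ.seminorm (p - q))
    ((fun a : selfAdjoint X.carrier => ((a : X.carrier), (0 : Y.carrier))) '' {a | X.L a ≤ 1})
    ((fun b : selfAdjoint Y.carrier => ((0 : X.carrier), (b : Y.carrier))) '' {b | Y.L b ≤ 1})

/-- The length of a bridge. -/
def Bridge.length : ℝ≥0∞ := max γ.height γ.reach

end Bridge

/-- A trek: a finite nonempty chain of bridges whose intermediate spaces are `(C, D)`-quasi-Leibniz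
quantum compact metric spaces. -/
inductive Trek (C D : ℝ≥0) : LipPair → LipPair → Type 1
  | single {X Y : LipPair} (γ : Bridge X.carrier Y.carrier) : Trek C D X Y
  | cons {X Z Y : LipPair} (γ : Bridge X.carrier Z.carrier) (hZ : IsQuasiLeibnizQCMS C D Z)
      (t : Trek C D Z Y) : Trek C D X Y

/-- The length of a trek: the sum of the lengths of its bridges. -/
def Trek.length {C D : ℝ≥0} : {X Y : LipPair} → Trek C D X Y → ℝ≥0∞
  | _, _, .single γ => γ.length
  | _, _, .cons γ _ t => γ.length + t.length

/-- The quantum propinquity on `(C, D)`-quasi-Leibniz quantum compact metric spaces: the infimum of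
the lengths of all treks, i.e. the largest pseudo-distance on this class that is bounded above by
the lengths of bridges. -/
def propinquity (C D : ℝ≥0) (X Y : LipPair) : ℝ≥0∞ := ⨅ t : Trek C D X Y, t.length

/-! ### Lip-norms from conditional expectations -/

section CondExp

variable {A : Type} [CStarAlgebra A]

/-- `E` is a conditional expectation of `A` onto the subalgebra `B`: a positive linear map of
norm `1`, onto `B`, with the bimodule property. -/
structure IsConditionalExpectation (B : StarSubalgebra ℂ A) (E : A →L[ℂ] A) : Prop where
  range_eq : Set.range E = B
  norm_eq : ‖E‖ = 1
  positive : ∀ a, ∃ b, E (star a * a) = star b * b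
  bimodule : ∀ b ∈ B, ∀ c ∈ B, ∀ a, E (b * a * c) = b * E a * c

/-- `E` is a conditional expectation onto `B` that preserves `μ`. -/
def IsPreservingExpectation (μ : A →ₗ[ℂ] ℂ) (B : StarSubalgebra ℂ A) (E : A →L[ℂ] A) : Prop :=
  IsConditionalExpectation B E ∧ ∀ a, μ (E a) = μ a

open Classical in
/-- The conditional expectation onto `B` that preserves `μ` (with value `0` if there is none). -/
def condExp (μ : A →ₗ[ℂ] ℂ) (B : StarSubalgebra ℂ A) : A →L[ℂ] A :=
  if h : ∃ E, IsPreservingExpectation μ B E then h.choose else 0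

/-- The Lip-norm `L(a) = sup_n ‖a - E_n a‖ / ϑ n`, where `E_n` is the conditional expectation onto
`B n` that preserves `μ`. -/
def lipNorm (B : ℕ → StarSubalgebra ℂ A) (μ : A →ₗ[ℂ] ℂ) (ϑ : ℕ → ℝ) (a : selfAdjoint A) : ℝ≥0∞ :=
  ⨆ n, ENNReal.ofReal (‖(a : A) - condExp μ (B n) a‖ / ϑ n)

end CondExp

/-! ### Inductive sequences of unital C*-algebras and their limits -/

/-- An inductive sequence of unital C*-algebras whose connecting maps are injective unital
*-homomorphisms. -/
structure CStarInductiveSequence where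
  obj : ℕ → Type
  [cstar : ∀ n, CStarAlgebra (obj n)]
  map : ∀ n, obj n →⋆ₐ[ℂ] obj (n + 1)
  map_injective : ∀ n, Function.Injective (map n)

attribute [instance] CStarInductiveSequence.cstar

/-- `A`, with the canonical maps `ι n`, is a C*-inductive limit of `I`: the `ι n` are injective
unital *-homomorphisms compatible with the connecting maps of `I`, and the union of their ranges
is dense. -/
structure IsCStarInductiveLimit (I : CStarInductiveSequence) {A : Type} [CStarAlgebra A]
    (ι : ∀ n, I.obj n →⋆ₐ[ℂ] A) : Prop where
  compatible : ∀ n a, ι (n + 1) (I.map n a) = ι n a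
  injective : ∀ n, Function.Injective (ι n)
  dense : Dense (⋃ n, Set.range (ι n))

namespace CStarInductiveSequence

variable (I : CStarInductiveSequence)

/-- The *-algebra of sequences that are eventually coherent along the connecting maps. -/
def coherent : StarSubalgebra ℂ (∀ n, I.obj n) where
  carrier := {x | ∃ N, ∀ n, N ≤ n → x (n + 1) = I.map n (x n)}
  mul_mem' := by
    rintro x y ⟨N, hN⟩ ⟨M, hM⟩
    exact ⟨max N M, fun n hn => by
      simp [hN n (le_of_max_le_left hn), hM n (le_of_max_le_right hn)]⟩
  add_mem' := by
    rintro x y ⟨N, hN⟩ ⟨M, hM⟩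
    exact ⟨max N M, fun n hn => by
      simp [hN n (le_of_max_le_left hn), hM n (le_of_max_le_right hn)]⟩
  algebraMap_mem' r := ⟨0, fun n _ => by
    simp only [Pi.algebraMap_apply]
    exact (AlgHomClass.commutes (I.map n) r).symm⟩
  star_mem' := by
    rintro x ⟨N, hN⟩
    exact ⟨N, fun n hn => by simp [hN n hn, map_star]⟩

/-- The eventually coherent sequences; this type carries the seminorm `lim ‖x n‖` below (not the
product topology). -/
def PreLimit : Type := I.coherent

instance : Ring I.PreLimit := inferInstanceAs (Ring I.coherent)
instance : Algebra ℂ I.PreLimit := inferInstanceAs (Algebra ℂ I.coherent)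
instance : StarRing I.PreLimit := inferInstanceAs (StarRing I.coherent)
instance : StarModule ℂ I.PreLimit := inferInstanceAs (StarModule ℂ I.coherent)

variable {I}

/-- The `n`-th term of an eventually coherent sequence. -/
def PreLimit.term (x : I.PreLimit) (n : ℕ) : I.obj n := (x : I.coherent).1 n

lemma PreLimit.eventually_coherent (x : I.PreLimit) :
    ∃ N, ∀ n, N ≤ n → x.term (n + 1) = I.map n (x.term n) := (x : I.coherent).2

lemma PreLimit.exists_norm (x : I.PreLimit) : ∃ c : ℝ, ∀ᶠ n in Filter.atTop, ‖x.term n‖ = c := by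
  obtain ⟨N, hN⟩ := x.eventually_coherent
  refine ⟨‖x.term N‖, Filter.eventually_atTop.2 ⟨N, fun n hn => ?_⟩⟩
  induction n, hn using Nat.le_induction with
  | base => rfl
  | succ n hn ih =>
    rw [hN n hn, NonUnitalStarAlgHom.norm_map (I.map n) (I.map_injective n), ih]

/-- The seminorm of an eventually coherent sequence, the limit (eventual value) of the norms of
its terms. -/
instance : Norm I.PreLimit := ⟨fun x => Filter.limUnder Filter.atTop fun n => ‖x.term n‖⟩

lemma PreLimit.norm_eventually (x : I.PreLimit) : ∀ᶠ n in Filter.atTop, ‖x.term n‖ = ‖x‖ := by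
  obtain ⟨c, hc⟩ := x.exists_norm
  have h : Filter.Tendsto (fun n => ‖x.term n‖) Filter.atTop (𝓝 c) :=
    tendsto_const_nhds.congr' (hc.mono fun n h => h.symm)
  have h' : ‖x‖ = c := h.limUnder_eq
  rw [h']
  exact hc

variable (I) in
/-- The seminorm on eventually coherent sequences, as a ring seminorm. -/
def PreLimit.ringSeminorm : RingSeminorm I.PreLimit where
  toFun x := ‖x‖
  map_zero' := by
    obtain ⟨n, hn⟩ := (PreLimit.norm_eventually (0 : I.PreLimit)).exists
    rw [← hn]
    exact norm_zero
  add_le' x y := by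
    obtain ⟨n, hx, hy, hxy⟩ := (x.norm_eventually.and
      (y.norm_eventually.and (x + y).norm_eventually)).exists
    rw [← hx, ← hy, ← hxy]
    exact norm_add_le _ _
  neg' x := by
    obtain ⟨n, hx, hx'⟩ := (x.norm_eventually.and (-x).norm_eventually).exists
    rw [← hx, ← hx']
    exact norm_neg _
  mul_le' x y := by
    obtain ⟨n, hx, hy, hxy⟩ := (x.norm_eventually.and
      (y.norm_eventually.and (x * y).norm_eventually)).exists
    rw [← hx, ← hy, ← hxy]
    exact norm_mul_le _ _

instance : SeminormedRing I.PreLimit := (PreLimit.ringSeminorm I).toSeminormedRing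

lemma PreLimit.norm_star' (x : I.PreLimit) : ‖star x‖ = ‖x‖ := by
  obtain ⟨n, hx, hx'⟩ := (x.norm_eventually.and (star x).norm_eventually).exists
  rw [← hx, ← hx']
  exact norm_star (x.term n)

lemma PreLimit.norm_star_mul_self' (x : I.PreLimit) : ‖star x * x‖ = ‖x‖ * ‖x‖ := by
  obtain ⟨n, hx, hx'⟩ := (x.norm_eventually.and (star x * x).norm_eventually).exists
  rw [← hx, ← hx']
  exact CStarRing.norm_star_mul_self (x := x.term n)

instance : NormedAlgebra ℂ I.PreLimit where
  norm_smul_le c x := by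
    obtain ⟨n, hx, hx'⟩ := (x.norm_eventually.and (c • x).norm_eventually).exists
    exact hx'.symm.trans_le ((norm_smul_le c (x.term n)).trans_eq (congrArg (‖c‖ * ·) hx))

instance : NormedStarGroup I.PreLimit := ⟨fun x => (PreLimit.norm_star' x).le⟩

variable (I)

/-- The C*-inductive limit of `I`: the (Hausdorff) completion of the *-algebra of eventually
coherent sequences for the seminorm `lim ‖x n‖`. -/
def Limit : Type := UniformSpace.Completion I.PreLimit

instance : NormedRing I.Limit := inferInstanceAs (NormedRing (UniformSpace.Completion I.PreLimit))
instance : CompleteSpace I.Limit :=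
  inferInstanceAs (CompleteSpace (UniformSpace.Completion I.PreLimit))
instance : Algebra ℂ I.Limit := inferInstanceAs (Algebra ℂ (UniformSpace.Completion I.PreLimit))

variable {I}

/-- The canonical map from eventually coherent sequences to the limit. -/
def Limit.mk (x : I.PreLimit) : I.Limit := (x : UniformSpace.Completion I.PreLimit)

lemma Limit.norm_mk (x : I.PreLimit) : ‖Limit.mk x‖ = ‖x‖ := UniformSpace.Completion.norm_coe x
lemma Limit.mk_mul (x y : I.PreLimit) : Limit.mk (x * y) = Limit.mk x * Limit.mk y :=
  UniformSpace.Completion.coe_mul x y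
lemma Limit.mk_add (x y : I.PreLimit) : Limit.mk (x + y) = Limit.mk x + Limit.mk y :=
  UniformSpace.Completion.coe_add x y
lemma Limit.mk_sub (x y : I.PreLimit) : Limit.mk (x - y) = Limit.mk x - Limit.mk y :=
  UniformSpace.Completion.coe_sub x y
lemma Limit.mk_algebraMap (c : ℂ) :
    Limit.mk (algebraMap ℂ I.PreLimit c) = algebraMap ℂ I.Limit c := rfl
lemma Limit.mk_smul (c : ℂ) (x : I.PreLimit) : Limit.mk (c • x) = c • Limit.mk x := by
  rw [Algebra.smul_def, Algebra.smul_def, Limit.mk_mul, Limit.mk_algebraMap]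

lemma Limit.denseRange_mk : DenseRange (Limit.mk : I.PreLimit → I.Limit) :=
  UniformSpace.Completion.denseRange_coe

lemma Limit.continuous_mk : Continuous (Limit.mk : I.PreLimit → I.Limit) :=
  UniformSpace.Completion.continuous_coe _

lemma Limit.induction {p : I.Limit → Prop} (x : I.Limit) (hp : IsClosed {x | p x})
    (h : ∀ x, p (Limit.mk x)) : p x :=
  UniformSpace.Completion.induction_on x hp h

instance : NormedAlgebra ℂ I.Limit where
  norm_smul_le c x := by
    have hc : Continuous fun x : I.Limit => ‖c • x‖ := by
      simp_rw [Algebra.smul_def]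
      fun_prop
    refine Limit.induction (p := fun x => ‖c • x‖ ≤ ‖c‖ * ‖x‖) x
      (isClosed_le hc (by fun_prop)) fun x => ?_
    rw [← Limit.mk_smul, Limit.norm_mk, Limit.norm_mk]
    exact norm_smul_le c x

instance : Star I.Limit :=
  ⟨fun x => UniformSpace.Completion.map (star : I.PreLimit → I.PreLimit) x⟩

lemma Limit.continuous_star' : Continuous (star : I.Limit → I.Limit) :=
  UniformSpace.Completion.continuous_map

lemma Limit.mk_star (x : I.PreLimit) : Limit.mk (star x) = star (Limit.mk x) :=
  (UniformSpace.Completion.map_coe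
    (star_isometry (E := I.PreLimit)).uniformContinuous x).symm

lemma Limit.induction₂ {p : I.Limit → I.Limit → Prop} (x y : I.Limit)
    (hp : IsClosed {q : I.Limit × I.Limit | p q.1 q.2})
    (h : ∀ x y, p (Limit.mk x) (Limit.mk y)) : p x y :=
  UniformSpace.Completion.induction_on₂ x y hp h

instance : StarRing I.Limit where
  star_involutive x := by
    have h := Limit.continuous_star' (I := I)
    refine Limit.induction (p := fun x => star (star x) = x) x
      (isClosed_eq (h.comp h) continuous_id) fun x => ?_
    rw [← Limit.mk_star, ← Limit.mk_star, star_star]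
  star_mul x y := by
    have h := Limit.continuous_star' (I := I)
    refine Limit.induction₂ (p := fun x y => star (x * y) = star y * star x) x y
      (isClosed_eq (by fun_prop) (by fun_prop)) fun x y => ?_
    rw [← Limit.mk_mul, ← Limit.mk_star, ← Limit.mk_star, ← Limit.mk_star, star_mul, Limit.mk_mul]
  star_add x y := by
    have h := Limit.continuous_star' (I := I)
    refine Limit.induction₂ (p := fun x y => star (x + y) = star x + star y) x y
      (isClosed_eq (by fun_prop) (by fun_prop)) fun x y => ?_
    rw [← Limit.mk_add, ← Limit.mk_star, ← Limit.mk_star, ← Limit.mk_star, star_add, Limit.mk_add]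

instance : CStarRing I.Limit where
  norm_mul_self_le x := by
    have h := Limit.continuous_star' (I := I)
    refine Limit.induction (p := fun x => ‖x‖ * ‖x‖ ≤ ‖star x * x‖) x
      (isClosed_le (by fun_prop) (by fun_prop)) fun x => ?_
    rw [← Limit.mk_star, ← Limit.mk_mul, Limit.norm_mk, Limit.norm_mk, PreLimit.norm_star_mul_self']

instance : StarModule ℂ I.Limit where
  star_smul c x := by
    have h := Limit.continuous_star' (I := I)
    refine Limit.induction (p := fun x => star (c • x) = star c • star x) x
      (isClosed_eq (h.comp (continuous_const_smul c)) (h.const_smul (star c))) fun x => ?_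
    rw [← Limit.mk_smul, ← Limit.mk_star, ← Limit.mk_star, ← Limit.mk_smul, star_smul]

instance : CStarAlgebra I.Limit where

/-- The composition `obj n → obj m` of the connecting maps, for `n ≤ m`. -/
def transition (I : CStarInductiveSequence) {n m : ℕ} (h : n ≤ m) : I.obj n →⋆ₐ[ℂ] I.obj m :=
  Nat.leRec (motive := fun m _ => I.obj n →⋆ₐ[ℂ] I.obj m) (StarAlgHom.id ℂ (I.obj n))
    (fun {m} _ f => (I.map m).comp f) h

lemma transition_self (n : ℕ) : I.transition (le_refl n) = StarAlgHom.id ℂ (I.obj n) :=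
  Nat.leRec_self _ _

lemma transition_succ {n m : ℕ} (h : n ≤ m) :
    I.transition (h.trans m.le_succ) = (I.map m).comp (I.transition h) :=
  Nat.leRec_succ _ _ h

/-- The sequence `0, …, 0, a, α_n a, α_{n+1} (α_n a), …`. -/
def push (n : ℕ) (a : I.obj n) : I.PreLimit :=
  (⟨fun m => if h : n ≤ m then I.transition h a else 0, n, fun m hm => by
    simp only [dif_pos hm, dif_pos (hm.trans m.le_succ)]
    exact DFunLike.congr_fun (transition_succ hm) a⟩ : I.coherent)

lemma push_term {n m : ℕ} (h : n ≤ m) (a : I.obj n) : (push n a).term m = I.transition h a :=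
  dif_pos h

lemma Limit.mk_eq_mk {x y : I.PreLimit} {N : ℕ} (h : ∀ n, N ≤ n → x.term n = y.term n) :
    Limit.mk x = Limit.mk y := by
  rw [← sub_eq_zero, ← Limit.mk_sub, ← norm_eq_zero, Limit.norm_mk]
  obtain ⟨n, hn, hn'⟩ := ((x - y).norm_eventually.and (Filter.eventually_ge_atTop N)).exists
  rw [← hn, norm_eq_zero]
  exact sub_eq_zero.2 (h n hn')

/-- The canonical *-homomorphism `obj n → Limit`. -/
def ι (I : CStarInductiveSequence) (n : ℕ) : I.obj n →⋆ₐ[ℂ] I.Limit where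
  toFun a := Limit.mk (push n a)
  map_one' := Limit.mk_eq_mk (N := n) (y := 1) fun m hm => by
    rw [push_term hm, map_one]; rfl
  map_mul' a b := by
    rw [← Limit.mk_mul]
    refine Limit.mk_eq_mk (N := n) fun m hm => ?_
    rw [push_term hm, map_mul, ← push_term hm a, ← push_term hm b]; rfl
  map_zero' := Limit.mk_eq_mk (N := n) (y := 0) fun m hm => by
    rw [push_term hm, map_zero]; rfl
  map_add' a b := by
    rw [← Limit.mk_add]
    refine Limit.mk_eq_mk (N := n) fun m hm => ?_
    rw [push_term hm, map_add, ← push_term hm a, ← push_term hm b]; rfl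
  commutes' c := Limit.mk_eq_mk (N := n) (y := algebraMap ℂ I.PreLimit c) fun m hm => by
    rw [push_term hm, AlgHomClass.commutes]; rfl
  map_star' a := by
    rw [← Limit.mk_star]
    refine Limit.mk_eq_mk (N := n) fun m hm => ?_
    rw [push_term hm, map_star, ← push_term hm a]; rfl

lemma ι_apply (n : ℕ) (a : I.obj n) : I.ι n a = Limit.mk (push n a) := rfl

lemma transition_map {n m : ℕ} (h : n + 1 ≤ m) (a : I.obj n) :
    I.transition h (I.map n a) = I.transition (n.le_succ.trans h) a := by
  induction m, h using Nat.le_induction with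
  | base =>
    rw [transition_self, transition_succ (le_refl n), transition_self]; rfl
  | succ m hm ih =>
    rw [transition_succ hm, transition_succ (n.le_succ.trans hm)]
    exact congrArg (I.map m) ih

variable (I) in
/-- `Limit`, with its canonical maps, is a C*-inductive limit. -/
theorem isCStarInductiveLimit : IsCStarInductiveLimit I I.ι where
  compatible n a := by
    rw [ι_apply, ι_apply]
    refine Limit.mk_eq_mk (N := n + 1) fun m hm => ?_
    rw [push_term hm, push_term (n.le_succ.trans hm), transition_map]
  injective n := by
    refine (injective_iff_map_eq_zero _).2 fun a ha => ?_
    have h0 : ‖push n a‖ = 0 := by rw [← Limit.norm_mk, ← ι_apply, ha, norm_zero]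
    obtain ⟨m, hm, hnm⟩ := ((push n a).norm_eventually.and (Filter.eventually_ge_atTop n)).exists
    rw [h0, push_term hnm, norm_eq_zero] at hm
    clear h0 ha
    induction m, hnm using Nat.le_induction with
    | base => rwa [transition_self] at hm
    | succ m hnm ih =>
      rw [transition_succ hnm] at hm
      exact ih ((map_eq_zero_iff (I.map m) (I.map_injective m)).1 hm)
  dense := by
    refine Limit.denseRange_mk.mono ?_
    rintro _ ⟨x, rfl⟩
    obtain ⟨N, hN⟩ := x.eventually_coherent
    refine Set.mem_iUnion.2 ⟨N, x.term N, ?_⟩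
    rw [ι_apply]
    refine Limit.mk_eq_mk (N := N) fun m hm => ?_
    rw [push_term hm]
    induction m, hm using Nat.le_induction with
    | base => rw [transition_self]; rfl
    | succ m hm ih =>
      rw [transition_succ hm, hN m hm, ← ih]
      rfl

end CStarInductiveSequence

/-! ### UHF algebras -/

/-- The class `UHF^k`: pairs `(A, L)` where `A` is infinite dimensional and is the C*-inductive
limit of a unital inductive sequence `I` of full matrix algebras starting with `ℂ`, and `L` is the
Lip-norm of `I`, of a faithful tracial state, and of the weights `dim (I n) ^ (-k)`. -/
def UHFClass (k : ℝ) (X : LipPair) : Prop :=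
  ¬ FiniteDimensional ℂ X.carrier ∧
  ∃ (I : CStarInductiveSequence) (ι : ∀ n, I.obj n →⋆ₐ[ℂ] X.carrier) (μ : X.carrier →ₗ[ℂ] ℂ),
    (∀ n, ∃ d : ℕ, Nonempty (I.obj n ≃⋆ₐ[ℂ] Matrix (Fin d) (Fin d) ℂ)) ∧
    Module.finrank ℂ (I.obj 0) = 1 ∧
    IsCStarInductiveLimit I ι ∧
    IsTracialState μ ∧ IsFaithful μ ∧
    X.L = lipNorm (fun n => (ι n).range) μ (fun n => (Module.finrank ℂ (I.obj n) : ℝ) ^ (-k))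

/-- The unital *-homomorphism `A ↦ diag (A, …, A)` (with `m` blocks). -/
def diagEmbedding (m d : ℕ) :
    Matrix (Fin d) (Fin d) ℂ →⋆ₐ[ℂ] Matrix (Fin (m * d)) (Fin (m * d)) ℂ where
  toFun A := Matrix.of fun i j => if i.divNat = j.divNat then A i.modNat j.modNat else 0
  map_one' := by
    ext i j
    have h : i = j ↔ i.divNat = j.divNat ∧ i.modNat = j.modNat := by
      rw [← finProdFinEquiv.symm.injective.eq_iff, Prod.ext_iff]; rfl
    simp only [Matrix.of_apply, Matrix.one_apply, h]
    split_ifs <;> simp_all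
  map_mul' A B := by
    ext i j
    simp only [Matrix.of_apply, Matrix.mul_apply, ← finProdFinEquiv.sum_comp,
      Fintype.sum_prod_type]
    have h1 : ∀ p : Fin m × Fin d, (finProdFinEquiv p).divNat = p.1 := fun p =>
      congrArg Prod.fst (finProdFinEquiv.symm_apply_apply p)
    have h2 : ∀ p : Fin m × Fin d, (finProdFinEquiv p).modNat = p.2 := fun p =>
      congrArg Prod.snd (finProdFinEquiv.symm_apply_apply p)
    simp only [h1, h2]
    rw [Finset.sum_eq_single i.divNat]
    · by_cases h : i.divNat = j.divNat <;> simp [h]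
    · intro b _ hb
      simp [hb.symm]
    · simp
  map_zero' := by
    ext i j; simp
  map_add' A B := by
    ext i j
    simp only [Matrix.of_apply, Matrix.add_apply]
    split_ifs <;> simp
  commutes' c := by
    ext i j
    have h : i = j ↔ i.divNat = j.divNat ∧ i.modNat = j.modNat := by
      rw [← finProdFinEquiv.symm.injective.eq_iff, Prod.ext_iff]; rfl
    simp only [Matrix.of_apply, Matrix.algebraMap_matrix_apply, h]
    split_ifs <;> simp_all
  map_star' A := by
    ext i j
    simp only [Matrix.of_apply, Matrix.star_apply, eq_comm (a := j.divNat)]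
    split_ifs <;> simp

lemma diagEmbedding_apply (m d : ℕ) (A : Matrix (Fin d) (Fin d) ℂ) (i j : Fin (m * d)) :
    diagEmbedding m d A i j = if i.divNat = j.divNat then A i.modNat j.modNat else 0 := rfl

lemma diagEmbedding_injective {m : ℕ} (hm : 0 < m) (d : ℕ) :
    Function.Injective (diagEmbedding m d) := by
  intro A B h
  ext i j
  have h0 := congrFun (congrFun h (finProdFinEquiv (⟨0, hm⟩, i))) (finProdFinEquiv (⟨0, hm⟩, j))
  have h1 : ∀ p : Fin m × Fin d, (finProdFinEquiv p).divNat = p.1 := fun p =>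
    congrArg Prod.fst (finProdFinEquiv.symm_apply_apply p)
  have h2 : ∀ p : Fin m × Fin d, (finProdFinEquiv p).modNat = p.2 := fun p =>
    congrArg Prod.snd (finProdFinEquiv.symm_apply_apply p)
  simpa only [diagEmbedding_apply, h1, h2, if_true] using h0

/-- The sizes `⊠β(n) = ∏_{j < n} (β(j) + 1)`. -/
def boxProd (β : ℕ → ℕ+) : ℕ → ℕ
  | 0 => 1
  | n + 1 => (β n + 1) * boxProd β n

lemma boxProd_eq_prod (β : ℕ → ℕ+) (n : ℕ) :
    boxProd β n = ∏ j ∈ Finset.range n, ((β j : ℕ) + 1) := by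
  induction n with
  | zero => rfl
  | succ n ih => rw [Finset.prod_range_succ, ← ih, mul_comm]; rfl

/-- The inductive sequence of the full matrix algebras of sizes `⊠β(n)` under the diagonal
embeddings. -/
def uhfSequence (β : ℕ → ℕ+) : CStarInductiveSequence where
  obj n := Matrix (Fin (boxProd β n)) (Fin (boxProd β n)) ℂ
  cstar _ := inferInstance
  map n := diagEmbedding (β n + 1) (boxProd β n)
  map_injective _ := diagEmbedding_injective (Nat.succ_pos _) _

/-- The UHF algebra of `β`. -/
abbrev uhfAlgebra (β : ℕ → ℕ+) : Type := (uhfSequence β).Limit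

open Classical in
/-- The tracial state of the UHF algebra of `β` (with value `0` if there were none). -/
def uhfTrace (β : ℕ → ℕ+) : uhfAlgebra β →ₗ[ℂ] ℂ :=
  if h : ∃ μ : uhfAlgebra β →ₗ[ℂ] ℂ, IsTracialState μ then h.choose else 0

/-- The image of the `n`-th matrix algebra in the UHF algebra of `β`. -/
def uhfStage (β : ℕ → ℕ+) (n : ℕ) : StarSubalgebra ℂ (uhfAlgebra β) :=
  ((uhfSequence β).ι n).range

/-- The UHF algebra of `β` with the Lip-norm of its inductive sequence, its trace and the
weights `ϑ`. -/
def uhf (β : ℕ → ℕ+) (ϑ : ℕ → ℝ) : LipPair where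
  carrier := uhfAlgebra β
  L := lipNorm (uhfStage β) (uhfTrace β) ϑ

/-- The weights `dim (M(⊠β(n))) ^ (-k)`. -/
def dimWeight (k : ℝ) (β : ℕ → ℕ+) (n : ℕ) : ℝ :=
  (Module.finrank ℂ ((uhfSequence β).obj n) : ℝ) ^ (-k)

/-- The weights `⊠β(n) ^ (-k)`. -/
def sizeWeight (k : ℝ) (β : ℕ → ℕ+) (n : ℕ) : ℝ := (boxProd β n : ℝ) ^ (-k)

open Classical in
/-- The metric of the Baire space. -/
def baireDist (β η : ℕ → ℕ+) : ℝ :=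
  if β = η then 0 else (2 : ℝ) ^ (-((sInf {n : ℕ | β n ≠ η n} : ℕ) : ℝ))

/-- `F` is a `(c, r)`-Hölder map, for the quantum propinquity `Λ_{2,0}`, from the Baire space into
the class `𝒞` of `(2, 0)`-quasi-Leibniz quantum compact metric spaces, onto `𝒞` up to isometric
isomorphism. -/
structure IsHolderSurjection (c r : ℝ) (F : (ℕ → ℕ+) → LipPair) (𝒞 : LipPair → Prop) : Prop where
  isQCMS : ∀ β, IsQuasiLeibnizQCMS 2 0 (F β)
  mem : ∀ β, 𝒞 (F β)
  holder : ∀ β η, propinquity 2 0 (F β) (F η) ≤ ENNReal.ofReal (c * baireDist β η ^ r)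
  surjective : ∀ X, 𝒞 X → ∃ β, IsometricallyIsomorphic (F β) X

end QuantumMetric

end

open QuantumMetric

open scoped NNReal ENNReal Topology Matrix.Norms.L2Operator ComplexOrder

noncomputable section

namespace QuantumMetric

/-! ### Positive functionals -/

section Functionals

variable {A : Type} [CStarAlgebra A]

/-! Expectations. On a finite-dimensional unital *-subalgebra `B`, a faithful trace `μ` makes the
pairing `μ (x * c)` nondegenerate. Hence every `a` has exactly one `E a` in `B` with `μ (E a * c) =
μ (a * c)` for all `c` in `B`, and this identity alone determines the expectation. Existence,
uniqueness, compatibility with *-homomorphisms, and `E n ∘ E N = E n` for `n ≤ N` are all read off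
from it.

Lip-norms. Since `E a * E b` lies in `B`, the distance from `a * b` to its expectation is at most
twice the Leibniz bound, whence the constants `(2, 0)`. Modulo scalars the unit ball lies within `ϑ
n` of a bounded subset of the `n`-th stage, so it is totally bounded, and the Monge–Kantorovich
metric induces the weak* topology (`IsTracialFiltration.isQuasiLeibnizQCMS`).

Trace. A matrix algebra has only its normalized trace. These traces are compatible with the diagonal
embeddings, hence define the unique trace of the limit. It is faithful because its GNS
representation is isometric on every stage (`IsCStarInductiveLimit.isFaithful`).

Hölder estimate. If `β` and `η` agree below `N`, the two algebras share their stages up to `N`, and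
both Lip-norms restrict to the same one on the `N`-th stage. A bridge with pivot `1` joins an
algebra to this stage. Its height is zero, since states extend through the expectation. Its reach is
at most `ϑ N`, since the expectation preserves the Lip-norm unit ball and moves its points by at
most `ϑ N` (`exists_stage_bridges`). Two such bridges give `2 * ϑ N`, and `ϑ N ≤ 2 ^ (-N * k)`
because every factor of `⊠β(N)` is at least `2`.

Surjectivity. Repeated stages of an inductive sequence contribute repeated terms to the supremum and
can be dropped. Along what remains, each inclusion of matrix algebras is unitarily equivalent to a
diagonal embedding (`exists_unitary_conj_diagEmbedding`), so parametrizations chosen recursively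
identify the limit, stage by stage, with some UHF algebra (`exists_equiv_uhfAlgebra`). Uniqueness of
the trace then forces the Lip-norms to correspond. -/

lemma exists_star_mul_self_of_norm_sq_sub (a : A) :
    ∃ b : A, (((‖a‖ ^ 2 : ℝ) : ℂ)) • (1 : A) - star a * a = star b * b := by
  let := CStarAlgebra.spectralOrder A
  have := CStarAlgebra.spectralOrderedRing A
  refine CStarAlgebra.nonneg_iff_eq_star_mul_self.1 (sub_nonneg.2 ?_)
  have h := CStarAlgebra.star_mul_le_algebraMap_norm_sq (a := a)
  rwa [Algebra.algebraMap_eq_smul_one, ← Complex.coe_smul] at h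

/-- Polarization: positivity makes the values at `star x * x` real, and comparing imaginary parts
for `x = a`, `1 + a` and `1 + i a` gives both components. -/
lemma IsState.map_star {φ : A →ₗ[ℂ] ℂ} (hφ : IsState φ) (a : A) : φ (star a) = star (φ a) := by
  have h1 := (hφ.2 (1 + a)).2
  have h2 := (hφ.2 (1 + Complex.I • a)).2
  have h3 := (hφ.2 a).2
  simp only [star_add, star_one, star_smul, add_mul, mul_add, one_mul, mul_one, smul_mul_assoc,
    mul_smul_comm, map_add, map_smul, hφ.1, smul_eq_mul, Complex.star_def, Complex.conj_I,
    Complex.add_im, Complex.mul_im, Complex.I_re, Complex.I_im, Complex.neg_re, Complex.neg_im,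
    Complex.one_im, Complex.zero_im, Complex.mul_re] at h1 h2 h3
  apply Complex.ext
  · simp only [Complex.star_def, Complex.conj_re]
    linarith
  · simp only [Complex.star_def, Complex.conj_im]
    linarith

/-- A positive linear functional as a bundled positive map. -/
def positiveFunctional [PartialOrder A] [StarOrderedRing A] {φ : A →ₗ[ℂ] ℂ} (hφ : IsState φ) :
    A →ₚ[ℂ] ℂ :=
  PositiveLinearMap.mk₀ φ fun x hx => by
    obtain ⟨b, rfl⟩ := CStarAlgebra.nonneg_iff_eq_star_mul_self.1 hx
    exact hφ.2 b

/-- Cauchy–Schwarz in the pre-GNS space, applied to the vectors of `1` and `a`; the bound on the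
latter comes from positivity of `‖a‖ ^ 2 - star a * a`. -/
lemma IsState.norm_apply_le {φ : A →ₗ[ℂ] ℂ} (hφ : IsState φ) (a : A) : ‖φ a‖ ≤ ‖a‖ := by
  let := CStarAlgebra.spectralOrder A
  have := CStarAlgebra.spectralOrderedRing A
  set f := positiveFunctional hφ
  have hfa : ∀ x, f x = φ x := fun x => rfl
  have hone : ‖f.toPreGNS 1‖ = 1 := by
    rw [PositiveLinearMap.preGNS_norm_def]
    simp [hfa, hφ.1]
  have ha : ‖f.toPreGNS a‖ ≤ ‖a‖ := by
    rw [PositiveLinearMap.preGNS_norm_def]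
    refine Real.sqrt_le_iff.2 ⟨norm_nonneg a, ?_⟩
    obtain ⟨b, hb⟩ := exists_star_mul_self_of_norm_sq_sub a
    have h := (hφ.2 b).1
    rw [← hb, map_sub, map_smul, hφ.1, smul_eq_mul, mul_one, Complex.zero_re, Complex.sub_re,
      Complex.ofReal_re, sub_nonneg] at h
    exact h
  have h := norm_inner_le_norm (𝕜 := ℂ) (f.toPreGNS 1) (f.toPreGNS a)
  rw [PositiveLinearMap.preGNS_inner_def, hone, one_mul] at h
  simp only [PositiveLinearMap.ofPreGNS_toPreGNS, star_one, one_mul, hfa] at h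
  exact h.trans ha

lemma IsState.continuous {φ : A →ₗ[ℂ] ℂ} (hφ : IsState φ) : Continuous φ :=
  (φ.mkContinuous 1 fun a => by simpa using hφ.norm_apply_le a).continuous

lemma IsState.apply_eq_re {φ : A →ₗ[ℂ] ℂ} (hφ : IsState φ) {a : A} (ha : IsSelfAdjoint a) :
    φ a = ((φ a).re : ℂ) := by
  have h := hφ.map_star a
  rw [ha.star_eq] at h
  exact (Complex.conj_eq_iff_re.1 h.symm).symm

lemma IsFaithful.eq_zero_of_mul {μ : A →ₗ[ℂ] ℂ} (hμ : IsTracialState μ) (hf : IsFaithful μ) {x : A}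
    (h : μ (x * star x) = 0) : x = 0 := by
  rw [hμ.2] at h
  exact hf x h

end Functionals

/-! ### Expectations onto finite-dimensional subalgebras -/

section Expectation

variable {A : Type} [CStarAlgebra A] {μ : A →ₗ[ℂ] ℂ}

lemma eq_of_forall_trace_mul_eq (hμ : IsTracialState μ) (hf : IsFaithful μ) {B : StarSubalgebra ℂ A}
    {x y : A} (hx : x ∈ B) (hy : y ∈ B) (h : ∀ c ∈ B, μ (x * c) = μ (y * c)) : x = y := by
  rw [← sub_eq_zero]
  refine hf.eq_zero_of_mul hμ ?_
  rw [sub_mul, map_sub, h _ (star_mem (sub_mem hx hy)), sub_self]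

/-- Faithfulness makes the map from `B` to its dual, `b ↦ μ (b * ·)`, injective, hence bijective by
dimension; `E` sends `a` to the element of `B` that represents `μ (a * ·)` on `B`. -/
lemma exists_linear_expectation (hμ : IsTracialState μ) (hf : IsFaithful μ)
    (B : StarSubalgebra ℂ A) [FiniteDimensional ℂ B] :
    ∃ E : A →ₗ[ℂ] B, ∀ a, ∀ c ∈ B, μ (E a * c) = μ (a * c) := by
  let P : A →ₗ[ℂ] Module.Dual ℂ B :=
    { toFun := fun a => μ ∘ₗ LinearMap.mulLeft ℂ a ∘ₗ B.subtype.toLinearMap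
      map_add' := fun x y => by ext c; simp [add_mul]
      map_smul' := fun x y => by ext c; simp }
  have hP : ∀ a (c : B), P a c = μ (a * c) := fun a c => rfl
  let Q : B →ₗ[ℂ] Module.Dual ℂ B := P ∘ₗ B.subtype.toLinearMap
  have hQ : ∀ (a c : B), Q a c = μ (a * c) := fun a c => rfl
  have hinj : Function.Injective Q := by
    intro x y hxy
    refine Subtype.ext (eq_of_forall_trace_mul_eq hμ hf x.2 y.2 fun c hc => ?_)
    rw [← hQ x ⟨c, hc⟩, hxy]
    rfl
  let e := LinearEquiv.ofInjectiveOfFinrankEq Q hinj Subspace.dual_finrank_eq.symm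
  refine ⟨e.symm.toLinearMap ∘ₗ P, fun a c hc => ?_⟩
  rw [← hP a ⟨c, hc⟩, ← hQ _ ⟨c, hc⟩]
  exact DFunLike.congr_fun (e.apply_symm_apply (P a)) _

/-- Testing against the negative part of `h` gives minus its cube, whose trace is both nonnegative
and nonpositive; faithfulness then kills the negative part. The subalgebra `B` is closed, so the
functional calculus takes place inside it. -/
lemma exists_eq_star_mul_self_of_trace_nonneg (hμ : IsTracialState μ) (hf : IsFaithful μ)
    {B : StarSubalgebra ℂ A} [FiniteDimensional ℂ B] {h : A} (hB : h ∈ B) (hsa : IsSelfAdjoint h)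
    (hpos : ∀ c ∈ B, 0 ≤ μ (star c * h * c)) : ∃ b ∈ B, h = star b * b := by
  have : IsClosed (B : Set A) :=
    Submodule.closed_of_finiteDimensional (Subalgebra.toSubmodule B.toSubalgebra)
  let := CStarAlgebra.spectralOrder B
  have := CStarAlgebra.spectralOrderedRing B
  let k : B := ⟨h, hB⟩
  have hk : IsSelfAdjoint k := Subtype.ext hsa
  -- Writing the negative part as `star s * s` exhibits its cube as `star (s * k⁻) * (s * k⁻)`, to
  -- which faithfulness applies.
  obtain ⟨s, hs⟩ := CStarAlgebra.nonneg_iff_eq_star_mul_self.1 (CFC.negPart_nonneg k)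
  have hnsa : star (k⁻) = k⁻ := (CFC.negPart_nonneg k).isSelfAdjoint
  have h1 : star (k⁻) * k * k⁻ = - (star (s * k⁻) * (s * k⁻)) := by
    conv_lhs => enter [1, 2]; rw [← CFC.posPart_sub_negPart k hk]
    rw [mul_assoc, sub_mul, CFC.posPart_mul_negPart, zero_sub, mul_neg, star_mul]
    conv_lhs => enter [1, 2, 1]; rw [hs]
    simp only [mul_assoc]
  have h2 := hpos (k⁻ : B) (k⁻ : B).2
  have h3 : star ((k⁻ : B) : A) * h * (k⁻ : B) =
      - (star ((s * k⁻ : B) : A) * ((s * k⁻ : B) : A)) := congrArg Subtype.val h1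
  rw [h3, map_neg] at h2
  have h4 := hμ.1.2 ((s * k⁻ : B) : A)
  have h5 : s * k⁻ = 0 := Subtype.ext (hf _ (le_antisymm (neg_nonneg.1 h2) h4))
  have h6 : k⁻ = 0 := by
    have : star (k⁻) * k⁻ = 0 := by
      rw [hnsa]
      nth_rewrite 1 [hs]
      rw [mul_assoc, h5, mul_zero]
    exact CStarRing.star_mul_self_eq_zero_iff _ |>.1 this
  have h7 : 0 ≤ k := (CFC.negPart_eq_zero_iff k hk).1 h6
  obtain ⟨b, hb⟩ := CStarAlgebra.nonneg_iff_eq_star_mul_self.1 h7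
  exact ⟨b, b.2, congrArg Subtype.val hb⟩

/-- All properties but positivity and contractivity follow from the uniqueness of the element of `B`
that pairs with `B` as `a` does. Positivity tests `E (star a * a)` against `star c` and `c`, and
contractivity comes from the Schwarz inequality. -/
theorem exists_isPreservingExpectation (hμ : IsTracialState μ) (hf : IsFaithful μ)
    (B : StarSubalgebra ℂ A) [FiniteDimensional ℂ B] : ∃ E, IsPreservingExpectation μ B E := by
  obtain ⟨E, hE⟩ := exists_linear_expectation hμ hf B
  have key : ∀ {a x : A}, x ∈ B → (∀ c ∈ B, μ (x * c) = μ (a * c)) → (E a : A) = x :=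
    fun hx h => eq_of_forall_trace_mul_eq hμ hf (E _).2 hx fun c hc => (hE _ c hc).trans (h c hc).symm
  have hid : ∀ b ∈ B, (E b : A) = b := fun b hb => key hb fun _ _ => rfl
  have hstar : ∀ a, (E (star a) : A) = star (E a : A) := fun a => key (star_mem (E a).2) fun c hc => by
    have h : star (E a : A) * c = star (star c * E a) := by simp
    have h' : star a * c = star (star c * a) := by simp
    rw [h, h', hμ.1.map_star, hμ.1.map_star, hμ.2, hE a _ (star_mem hc), hμ.2]
  have hbi : ∀ b ∈ B, ∀ c ∈ B, ∀ a, (E (b * a * c) : A) = b * E a * c := fun b hb c hc a =>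
    key (mul_mem (mul_mem hb (E a).2) hc) fun d hd => by
      have h : ∀ x : A, μ (b * x * c * d) = μ (x * (c * d * b)) := fun x => by
        rw [mul_assoc, mul_assoc, hμ.2]; simp only [mul_assoc]
      rw [h, h, hE a _ (mul_mem (mul_mem hc hd) hb)]
  have hpos : ∀ a, ∃ b, (E (star a * a) : A) = star b * b := fun a => by
    suffices h : ∃ b ∈ B, (E (star a * a) : A) = star b * b from ⟨h.choose, h.choose_spec.2⟩
    refine exists_eq_star_mul_self_of_trace_nonneg hμ hf (E _).2 ?_ fun c hc => ?_
    · rw [IsSelfAdjoint, ← hstar, star_mul, star_star]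
    · rw [← hbi _ (star_mem hc) _ hc]
      have h := hE (star c * (star a * a) * c) 1 (one_mem B)
      rw [mul_one, mul_one] at h
      rw [h]
      have h' : star c * (star a * a) * c = star (a * c) * (a * c) := by
        simp only [star_mul, mul_assoc]
      rw [h']
      exact hμ.1.2 _
  have hnorm : ∀ a, ‖(E a : A)‖ ≤ 1 * ‖a‖ := fun a => by
    let := CStarAlgebra.spectralOrder A
    have := CStarAlgebra.spectralOrderedRing A
    -- Schwarz inequality: expand the positive element `E (star (a - E a) * (a - E a))` by the
    -- bimodule property.
    have hschwarz : star (E a : A) * E a ≤ E (star a * a) := by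
      obtain ⟨b, hb⟩ := hpos (a - E a)
      have h1 : (E (star (a - E a) * (a - E a)) : A) = E (star a * a) - star (E a : A) * E a := by
        have e1 : star (a - E a) * (a - E a) = star a * a - 1 * star a * E a
            - star (E a : A) * a * 1 + 1 * (star (E a : A) * E a) * 1 := by
          simp only [star_sub]; noncomm_ring
        rw [e1, map_add, map_sub, map_sub]
        push_cast
        rw [hbi _ (one_mem B) _ (E a).2, hbi _ (star_mem (E a).2) _ (one_mem B), hstar,
          hid (1 * (star (E a : A) * E a) * 1)
            (by simpa using mul_mem (star_mem (E a).2) (E a).2)]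
        noncomm_ring
      rw [← sub_nonneg, ← h1, hb]
      exact star_mul_self_nonneg b
    have hle : (E (star a * a) : A) ≤ algebraMap ℝ A (‖a‖ ^ 2) := by
      obtain ⟨b, hb⟩ := exists_star_mul_self_of_norm_sq_sub a
      obtain ⟨c, hc⟩ := hpos b
      rw [← hb, map_sub, map_smul] at hc
      push_cast at hc
      rw [hid 1 (one_mem B)] at hc
      rw [← sub_nonneg, Algebra.algebraMap_eq_smul_one, ← Complex.coe_smul]
      push_cast
      rw [hc]
      exact star_mul_self_nonneg c
    have h0 : (0 : A) ≤ star (E a : A) * E a := star_mul_self_nonneg _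
    have h1 : ‖star (E a : A) * E a‖ ≤ ‖a‖ ^ 2 :=
      (CStarAlgebra.norm_le_iff_le_algebraMap _ (by positivity) h0).2 (hschwarz.trans hle)
    rw [CStarRing.norm_star_mul_self, ← pow_two] at h1
    rw [one_mul]
    exact le_of_sq_le_sq h1 (norm_nonneg _)
  have : Nontrivial A := ⟨1, 0, fun h => by
    have := hμ.1.1
    rw [h, map_zero] at this
    exact zero_ne_one this⟩
  refine ⟨(B.subtype.toLinearMap ∘ₗ E).mkContinuous 1 hnorm, ⟨?_, ?_, hpos, hbi⟩, fun a => ?_⟩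
  · ext x
    exact ⟨by rintro ⟨a, rfl⟩; exact (E a).2, fun hx => ⟨x, hid x hx⟩⟩
  · refine le_antisymm (LinearMap.mkContinuous_norm_le _ zero_le_one hnorm) ?_
    have h := ((B.subtype.toLinearMap ∘ₗ E).mkContinuous 1 hnorm).le_opNorm 1
    have h1 : ((B.subtype.toLinearMap ∘ₗ E).mkContinuous 1 hnorm) 1 = 1 := hid 1 (one_mem B)
    rwa [h1, norm_one, mul_one] at h
  · have h := hE a 1 (one_mem B)
    rw [mul_one, mul_one] at h
    exact h

lemma IsPreservingExpectation.mem {B : StarSubalgebra ℂ A} {E : A →L[ℂ] A}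
    (hE : IsPreservingExpectation μ B E) (a : A) : E a ∈ B := by
  have h : E a ∈ Set.range E := ⟨a, rfl⟩
  rwa [hE.1.range_eq] at h

lemma IsPreservingExpectation.trace_mul {B : StarSubalgebra ℂ A} {E : A →L[ℂ] A}
    (hE : IsPreservingExpectation μ B E) (a : A) {c : A} (hc : c ∈ B) :
    μ (E a * c) = μ (a * c) := by
  have h := hE.1.bimodule 1 (one_mem B) c hc a
  rw [one_mul, one_mul] at h
  rw [← h, hE.2]

theorem IsPreservingExpectation.unique (hμ : IsTracialState μ) (hf : IsFaithful μ)
    {B : StarSubalgebra ℂ A} {E F : A →L[ℂ] A} (hE : IsPreservingExpectation μ B E)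
    (hF : IsPreservingExpectation μ B F) : E = F := by
  ext a
  exact eq_of_forall_trace_mul_eq hμ hf (hE.mem a) (hF.mem a) fun c hc => by
    rw [hE.trace_mul a hc, hF.trace_mul a hc]

lemma condExp_spec (hμ : IsTracialState μ) (hf : IsFaithful μ)
    (B : StarSubalgebra ℂ A) [FiniteDimensional ℂ B] :
    IsPreservingExpectation μ B (condExp μ B) := by
  have h := exists_isPreservingExpectation hμ hf B
  rw [condExp, dif_pos h]
  exact h.choose_spec

lemma condExp_eq (hμ : IsTracialState μ) (hf : IsFaithful μ) {B : StarSubalgebra ℂ A}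
    [FiniteDimensional ℂ B] {a x : A} (hx : x ∈ B) (h : ∀ c ∈ B, μ (x * c) = μ (a * c)) :
    condExp μ B a = x :=
  have hE := condExp_spec hμ hf B
  eq_of_forall_trace_mul_eq hμ hf (hE.mem a) hx fun c hc =>
    (hE.trace_mul a hc).trans (h c hc).symm

lemma condExp_of_mem (hμ : IsTracialState μ) (hf : IsFaithful μ) {B : StarSubalgebra ℂ A}
    [FiniteDimensional ℂ B] {a : A} (ha : a ∈ B) : condExp μ B a = a :=
  condExp_eq hμ hf ha fun _ _ => rfl

lemma norm_condExp_le (hμ : IsTracialState μ) (hf : IsFaithful μ) (B : StarSubalgebra ℂ A)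
    [FiniteDimensional ℂ B] (a : A) : ‖condExp μ B a‖ ≤ ‖a‖ := by
  have h := (condExp μ B).le_opNorm a
  rwa [(condExp_spec hμ hf B).1.norm_eq, one_mul] at h

lemma condExp_star (hμ : IsTracialState μ) (hf : IsFaithful μ) (B : StarSubalgebra ℂ A)
    [FiniteDimensional ℂ B] (a : A) : condExp μ B (star a) = star (condExp μ B a) := by
  have hE := condExp_spec hμ hf B
  refine condExp_eq hμ hf (star_mem (hE.mem a)) fun c hc => ?_
  have h : star (condExp μ B a) * c = star (star c * condExp μ B a) := by simp
  have h' : star a * c = star (star c * a) := by simp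
  rw [h, h', hμ.1.map_star, hμ.1.map_star, hμ.2, hE.trace_mul a (star_mem hc), hμ.2]

lemma exists_mem_condExp_star_mul_self (hμ : IsTracialState μ) (hf : IsFaithful μ)
    (B : StarSubalgebra ℂ A) [FiniteDimensional ℂ B] (a : A) :
    ∃ b ∈ B, condExp μ B (star a * a) = star b * b := by
  have hE := condExp_spec hμ hf B
  refine exists_eq_star_mul_self_of_trace_nonneg hμ hf (hE.mem _) ?_ fun c hc => ?_
  · rw [IsSelfAdjoint, ← condExp_star hμ hf, star_mul, star_star]
  · rw [← hE.1.bimodule _ (star_mem hc) _ hc, hE.2]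
    have h : star c * (star a * a) * c = star (a * c) * (a * c) := by
      simp only [star_mul, mul_assoc]
    rw [h]
    exact hμ.1.2 _

/-- Preserving expectations are compatible with trace-preserving injective *-homomorphisms. -/
lemma condExp_map {Z : Type} [CStarAlgebra Z] {j : Z →⋆ₐ[ℂ] A} {ν : Z →ₗ[ℂ] ℂ}
    (hν : IsTracialState ν) (hνf : IsFaithful ν) (hμ : IsTracialState μ) (hf : IsFaithful μ)
    (hj : ∀ z, μ (j z) = ν z) {C : StarSubalgebra ℂ Z} {B : StarSubalgebra ℂ A}
    [FiniteDimensional ℂ C] [FiniteDimensional ℂ B] (hCB : C.map j = B) (z : Z) :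
    condExp μ B (j z) = j (condExp ν C z) := by
  have hE := condExp_spec hν hνf C
  subst hCB
  refine condExp_eq hμ hf ⟨_, hE.mem z, rfl⟩ ?_
  rintro _ ⟨c, hc, rfl⟩
  have := hE.trace_mul z hc
  rw [← hj, ← hj, map_mul j, map_mul j] at this
  exact this

end Expectation

/-! ### Lip-norms of tracial filtrations -/

section Filtration

variable {A : Type} [CStarAlgebra A]

lemma State.apply_add (φ : State A) (a b : A) : φ (a + b) = φ a + φ b := φ.1.map_add a b

lemma State.apply_sub (φ : State A) (a b : A) : φ (a - b) = φ a - φ b := φ.1.map_sub a b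

lemma State.apply_smul (φ : State A) (c : ℂ) (a : A) : φ (c • a) = c * φ a := φ.1.map_smul c a

lemma State.apply_sub_smul_one (φ : State A) (a : A) (c : ℂ) : φ (a - c • (1 : A)) = φ a - c := by
  have h : φ 1 = 1 := φ.2.1
  rw [State.apply_sub, State.apply_smul, h, mul_one]

/-- An increasing sequence of finite-dimensional unital *-subalgebras starting with the scalars,
with dense union, in a C*-algebra with a faithful tracial state. -/
structure IsTracialFiltration (B : ℕ → StarSubalgebra ℂ A) (μ : A →ₗ[ℂ] ℂ) : Prop where
  tracial : IsTracialState μ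
  faithful : IsFaithful μ
  finite : ∀ n, FiniteDimensional ℂ (B n)
  mono : Monotone B
  dense : Dense (⋃ n, (B n : Set A))
  scalar : ∀ a ∈ B 0, ∃ c : ℂ, a = c • (1 : A)

namespace IsTracialFiltration

variable {B : ℕ → StarSubalgebra ℂ A} {μ : A →ₗ[ℂ] ℂ} {ϑ : ℕ → ℝ}

lemma condExp_zero (h : IsTracialFiltration B μ) (a : A) :
    condExp μ (B 0) a = μ a • (1 : A) := by
  have := h.finite 0
  refine condExp_eq h.tracial h.faithful (SMulMemClass.smul_mem _ (one_mem (B 0))) fun c hc => ?_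
  obtain ⟨z, rfl⟩ := h.scalar c hc
  simp [h.tracial.1.1, mul_comm]

lemma condExp_smul_one (h : IsTracialFiltration B μ) (n : ℕ) (c : ℂ) :
    condExp μ (B n) (c • (1 : A)) = c • (1 : A) :=
  have := h.finite n
  condExp_of_mem h.tracial h.faithful (SMulMemClass.smul_mem _ (one_mem (B n)))

/-- The element `E a * E b` of the subalgebra approximates `a * b` with the plain Leibniz bound;
replacing it by the expectation of `a * b` at most doubles the error. -/
lemma norm_mul_sub_condExp_le (h : IsTracialFiltration B μ) (n : ℕ) (a b : A) :
    ‖a * b - condExp μ (B n) (a * b)‖ ≤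
      2 * (‖a‖ * ‖b - condExp μ (B n) b‖ + ‖b‖ * ‖a - condExp μ (B n) a‖) := by
  have := h.finite n
  have hE := condExp_spec h.tracial h.faithful (B n)
  set E := condExp μ (B n)
  have hab : E (E a * E b) = E a * E b :=
    condExp_of_mem h.tracial h.faithful (mul_mem (hE.mem a) (hE.mem b))
  have h1 : ‖a * b - E a * E b‖ ≤ ‖a‖ * ‖b - E b‖ + ‖b‖ * ‖a - E a‖ := by
    have e : a * b - E a * E b = a * (b - E b) + (a - E a) * E b := by noncomm_ring
    rw [e]
    refine (norm_add_le _ _).trans (add_le_add (norm_mul_le _ _) ((norm_mul_le _ _).trans ?_))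
    rw [mul_comm]
    exact mul_le_mul_of_nonneg_right (norm_condExp_le h.tracial h.faithful (B n) b) (norm_nonneg _)
  have e : a * b - E (a * b) = (a * b - E a * E b) - E (a * b - E a * E b) := by
    rw [map_sub, hab]; abel
  rw [e]
  have h2 := norm_condExp_le h.tracial h.faithful (B n) (a * b - E a * E b)
  have h3 := norm_sub_le (a * b - E a * E b) (E (a * b - E a * E b))
  linarith

lemma lipNorm_le_one_iff (hϑ : ∀ n, 0 < ϑ n) {a : selfAdjoint A} :
    lipNorm B μ ϑ a ≤ 1 ↔ ∀ n, ‖(a : A) - condExp μ (B n) a‖ ≤ ϑ n := by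
  simp only [lipNorm, iSup_le_iff, ENNReal.ofReal_le_one]
  exact forall_congr' fun n => div_le_one (hϑ n)

lemma norm_sub_trace_le (h : IsTracialFiltration B μ) (hϑ : ∀ n, 0 < ϑ n) {a : selfAdjoint A}
    (ha : lipNorm B μ ϑ a ≤ 1) : ‖(a : A) - μ a • (1 : A)‖ ≤ ϑ 0 := by
  rw [← h.condExp_zero]
  exact (lipNorm_le_one_iff hϑ).1 ha 0

lemma lipNorm_add_le (hϑ : ∀ n, 0 < ϑ n) (a b : selfAdjoint A) :
    lipNorm B μ ϑ (a + b) ≤ lipNorm B μ ϑ a + lipNorm B μ ϑ b := by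
  refine iSup_le fun n => ?_
  refine le_trans ?_ (add_le_add (le_iSup _ n) (le_iSup _ n))
  have h0 := (hϑ n).le
  rw [← ENNReal.ofReal_add (by positivity) (by positivity), ← add_div]
  refine ENNReal.ofReal_le_ofReal (div_le_div_of_nonneg_right ?_ h0)
  have e : ((a + b : selfAdjoint A) : A) - condExp μ (B n) ((a + b : selfAdjoint A) : A) =
      (a - condExp μ (B n) a) + (b - condExp μ (B n) b) := by
    simp only [AddSubgroup.coe_add, map_add]; abel
  rw [e]
  exact norm_add_le _ _

lemma lipNorm_smul (t : ℝ) (a : selfAdjoint A) :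
    lipNorm B μ ϑ (t • a) = ‖t‖ₑ * lipNorm B μ ϑ a := by
  rw [lipNorm, lipNorm, ENNReal.mul_iSup]
  refine iSup_congr fun n => ?_
  rw [Real.enorm_eq_ofReal_abs, ← ENNReal.ofReal_mul (abs_nonneg t), ← mul_div_assoc]
  congr 2
  have e : ((t • a : selfAdjoint A) : A) - condExp μ (B n) ((t • a : selfAdjoint A) : A) =
      t • (a - condExp μ (B n) a) := by
    rw [selfAdjoint.val_smul, ← Complex.coe_smul, map_smul, ← smul_sub, Complex.coe_smul]
  rw [e, norm_smul, Real.norm_eq_abs]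

lemma lipNorm_lt_top (h : IsTracialFiltration B μ) {n : ℕ} {a : selfAdjoint A}
    (ha : (a : A) ∈ B n) : lipNorm B μ ϑ a < ⊤ := by
  -- Only the terms before `n` can be nonzero, so a finite sum dominates the supremum.
  have hle : lipNorm B μ ϑ a ≤
      ∑ m ∈ Finset.range n, ENNReal.ofReal (‖(a : A) - condExp μ (B m) a‖ / ϑ m) := by
    refine iSup_le fun m => ?_
    by_cases hm : m < n
    · exact Finset.single_le_sum (f := fun m => ENNReal.ofReal (‖(a : A) - condExp μ (B m) a‖ / ϑ m))
        (fun _ _ => zero_le) (Finset.mem_range.2 hm)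
    · have := h.finite m
      rw [condExp_of_mem h.tracial h.faithful (h.mono (not_lt.1 hm) ha)]
      simp
  exact hle.trans_lt (ENNReal.sum_lt_top.2 fun _ _ => ENNReal.ofReal_lt_top)

lemma realPart_mem {B : StarSubalgebra ℂ A} {b : A} (hb : b ∈ B) : (realPart b : A) ∈ B := by
  rw [realPart_apply_coe, ← Complex.coe_smul]
  exact SMulMemClass.smul_mem _ (add_mem hb (star_mem hb))

lemma imaginaryPart_mem {B : StarSubalgebra ℂ A} {b : A} (hb : b ∈ B) :
    (imaginaryPart b : A) ∈ B := by
  rw [imaginaryPart_apply_coe, ← Complex.coe_smul]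
  exact SMulMemClass.smul_mem _ (SMulMemClass.smul_mem _ (sub_mem hb (star_mem hb)))

lemma dense_lipNorm_lt_top (h : IsTracialFiltration B μ) : Dense {a | lipNorm B μ ϑ a < ⊤} := by
  refine Metric.dense_iff.2 fun a r hr => ?_
  obtain ⟨b, hb, hB⟩ := Metric.dense_iff.1 h.dense (a : A) r hr
  obtain ⟨n, hn⟩ := Set.mem_iUnion.1 hB
  refine ⟨realPart b, ?_, h.lipNorm_lt_top (n := n) (realPart_mem hn)⟩
  rw [Metric.mem_ball, dist_eq_norm] at hb ⊢
  have e : realPart b - a = realPart (b - a : A) := by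
    rw [map_sub]
    congr 1
    exact Subtype.ext (IsSelfAdjoint.coe_realPart a.2).symm
  rw [e]
  exact (realPart.norm_le _).trans_lt hb

lemma lipNorm_eq_zero_iff (h : IsTracialFiltration B μ) (hϑ : ∀ n, 0 < ϑ n) (a : selfAdjoint A) :
    lipNorm B μ ϑ a = 0 ↔ ∃ t : ℝ, (a : A) = (t : ℂ) • (1 : A) := by
  constructor
  · intro ha
    refine ⟨(μ a).re, ?_⟩
    rw [← h.tracial.1.apply_eq_re a.2, ← h.condExp_zero, ← sub_eq_zero, ← norm_le_zero_iff]
    have h0 := (ENNReal.iSup_eq_zero.1 ha) 0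
    rw [ENNReal.ofReal_eq_zero] at h0
    have := (div_le_iff₀ (hϑ 0)).1 h0
    rwa [zero_mul] at this
  · rintro ⟨t, ht⟩
    refine ENNReal.iSup_eq_zero.2 fun n => ?_
    rw [ht, h.condExp_smul_one]
    simp

/-- Common to the Jordan and the Lie product: both are half a combination of `a * b` and `b * a`
with unimodular coefficients. -/
lemma lipNorm_half_smul_le (h : IsTracialFiltration B μ) (hϑ : ∀ n, 0 < ϑ n) (a b c : selfAdjoint A)
    (hc : ∀ n, ‖(c : A) - condExp μ (B n) c‖ ≤
      (1 / 2) * (‖(a * b : A) - condExp μ (B n) (a * b : A)‖ +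
        ‖(b * a : A) - condExp μ (B n) (b * a : A)‖)) :
    lipNorm B μ ϑ c ≤
      2 * (‖(a : A)‖ₑ * lipNorm B μ ϑ b + ‖(b : A)‖ₑ * lipNorm B μ ϑ a) := by
  refine iSup_le fun n => ?_
  have h1 := h.norm_mul_sub_condExp_le n a b
  have h2 := h.norm_mul_sub_condExp_le n b a
  have h3 : ‖(c : A) - condExp μ (B n) c‖ ≤ 2 * (‖(a : A)‖ * ‖(b : A) - condExp μ (B n) b‖ +
      ‖(b : A)‖ * ‖(a : A) - condExp μ (B n) a‖) := by
    linarith [hc n]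
  have h0 := (hϑ n).le
  calc ENNReal.ofReal (‖(c : A) - condExp μ (B n) c‖ / ϑ n)
      ≤ ENNReal.ofReal (2 * (‖(a : A)‖ * (‖(b : A) - condExp μ (B n) b‖ / ϑ n) +
          ‖(b : A)‖ * (‖(a : A) - condExp μ (B n) a‖ / ϑ n))) := by
        refine ENNReal.ofReal_le_ofReal ((div_le_div_of_nonneg_right h3 h0).trans_eq ?_)
        ring
    _ = 2 * (‖(a : A)‖ₑ * ENNReal.ofReal (‖(b : A) - condExp μ (B n) b‖ / ϑ n) +
          ‖(b : A)‖ₑ * ENNReal.ofReal (‖(a : A) - condExp μ (B n) a‖ / ϑ n)) := by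
        rw [ENNReal.ofReal_mul zero_le_two, ENNReal.ofReal_add (by positivity) (by positivity),
          ENNReal.ofReal_mul (norm_nonneg _), ENNReal.ofReal_mul (norm_nonneg _), ofReal_norm,
          ofReal_norm]
        simp
    _ ≤ _ := by
        gcongr <;> exact le_iSup (fun n => ENNReal.ofReal (_ / ϑ n)) n

lemma enorm_sub_le_mul (φ ψ : State A) {a : selfAdjoint A} {t : ℝ} (ht : 0 < t)
    (ha : lipNorm B μ ϑ a ≤ ENNReal.ofReal t) :
    ‖φ a - ψ a‖ₑ ≤ ENNReal.ofReal t * mongeKantorovich (lipNorm B μ ϑ) φ ψ := by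
  have h1 : lipNorm B μ ϑ (t⁻¹ • a) ≤ 1 := by
    rw [lipNorm_smul, Real.enorm_eq_ofReal_abs, abs_of_pos (inv_pos.2 ht)]
    refine (mul_le_mul_right ha _).trans ?_
    rw [← ENNReal.ofReal_mul (inv_pos.2 ht).le, inv_mul_cancel₀ ht.ne', ENNReal.ofReal_one]
  have h2 : ‖φ (t⁻¹ • a : selfAdjoint A) - ψ (t⁻¹ • a : selfAdjoint A)‖ₑ ≤
      mongeKantorovich (lipNorm B μ ϑ) φ ψ := by
    rw [mongeKantorovich]
    exact le_iSup₂_of_le _ h1 le_rfl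
  refine le_trans (le_of_eq ?_) (mul_le_mul_right h2 _)
  have e : (φ a - ψ a) = (t : ℂ) * (φ (t⁻¹ • a : selfAdjoint A) - ψ (t⁻¹ • a : selfAdjoint A)) := by
    rw [selfAdjoint.val_smul, ← Complex.coe_smul, State.apply_smul, State.apply_smul, ← mul_sub,
      ← mul_assoc, ← Complex.ofReal_mul, mul_inv_cancel₀ ht.ne', Complex.ofReal_one, one_mul]
  rw [e, enorm_mul, ← ofReal_norm (t : ℂ), Complex.norm_real, Real.norm_eq_abs, abs_of_pos ht]

lemma mongeKantorovich_le {L : selfAdjoint A → ℝ≥0∞}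
    {φ ψ : State A} {r : ℝ} (H : ∀ a : selfAdjoint A, L a ≤ 1 → ‖φ a - ψ a‖ ≤ r) :
    mongeKantorovich L φ ψ ≤ ENNReal.ofReal r := by
  refine iSup₂_le fun a ha => ?_
  rw [← ofReal_norm]
  exact ENNReal.ofReal_le_ofReal (H a ha)

/-- Up to scalars, the unit ball of the Lip-norm is totally bounded. -/
lemma exists_finite_net (h : IsTracialFiltration B μ) (hϑ : ∀ n, 0 < ϑ n)
    (hlim : Filter.Tendsto ϑ Filter.atTop (𝓝 0)) {ε : ℝ} (hε : 0 < ε) :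
    ∃ F : Set A, F.Finite ∧ ∀ a : selfAdjoint A, lipNorm B μ ϑ a ≤ 1 →
      ∃ x ∈ F, ∃ c : ℂ, ‖(a : A) - c • (1 : A) - x‖ ≤ ε := by
  -- Half of `ε` pays for replacing `a` by its expectation at stage `n`, the other half for the net
  -- in the compact ball of radius `ϑ 0` of that stage.
  obtain ⟨n, hn⟩ := (hlim.eventually (gt_mem_nhds (half_pos hε))).exists
  have hfin := h.finite n
  let S : Submodule ℂ A := Subalgebra.toSubmodule (B n).toSubalgebra
  have : FiniteDimensional ℂ S := hfin
  have : ProperSpace S := FiniteDimensional.proper ℂ S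
  have hK : IsCompact (S.subtype '' Metric.closedBall (0 : S) (ϑ 0)) :=
    (isCompact_closedBall (0 : S) (ϑ 0)).image continuous_subtype_val
  obtain ⟨F, hF, hcover⟩ := Metric.totallyBounded_iff.1 hK.totallyBounded (ε / 2) (half_pos hε)
  refine ⟨F, hF, fun a ha => ?_⟩
  have hE := condExp_spec h.tracial h.faithful (B n)
  have hy : condExp μ (B n) (a - μ a • (1 : A)) ∈ S.subtype '' Metric.closedBall (0 : S) (ϑ 0) := by
    refine ⟨⟨_, hE.mem (a - μ a • (1 : A))⟩, ?_, rfl⟩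
    rw [mem_closedBall_zero_iff]
    exact (norm_condExp_le h.tracial h.faithful (B n) _).trans (h.norm_sub_trace_le hϑ ha)
  obtain ⟨x, hx, hxy⟩ := Set.mem_iUnion₂.1 (hcover hy)
  refine ⟨x, hx, μ a, ?_⟩
  rw [Metric.mem_ball, dist_eq_norm, map_sub, h.condExp_smul_one] at hxy
  have h1 := (lipNorm_le_one_iff hϑ).1 ha n
  have e : (a : A) - μ a • (1 : A) - x =
      (a - condExp μ (B n) a) + (condExp μ (B n) a - μ a • (1 : A) - x) := by abel
  rw [e]
  refine (norm_add_le _ _).trans ?_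
  linarith

/-- Convergence for the Monge–Kantorovich metric gives convergence on self-adjoint elements of
finite Lip-norm, hence on every stage by real and imaginary parts, hence everywhere by density,
states being contractive. -/
lemma tendsto_apply (h : IsTracialFiltration B μ) (φ : State A) (x : A) :
    Filter.Tendsto (fun ψ : State A => ψ x)
      (Filter.comap (mongeKantorovich (lipNorm B μ ϑ) φ) (𝓝 0)) (𝓝 (φ x)) := by
  set l := Filter.comap (mongeKantorovich (lipNorm B μ ϑ) φ) (𝓝 0)
  have h1 : ∀ n, ∀ a : selfAdjoint A, (a : A) ∈ B n →
      Filter.Tendsto (fun ψ : State A => ψ a) l (𝓝 (φ a)) := by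
    intro n a ha
    have hlt := h.lipNorm_lt_top (ϑ := ϑ) ha
    -- Adding `1` keeps the scaling factor positive when `a` is a scalar.
    set t := (lipNorm B μ ϑ a).toReal + 1
    have ht : 0 < t := by positivity
    have hat : lipNorm B μ ϑ a ≤ ENNReal.ofReal t :=
      (ENNReal.le_ofReal_iff_toReal_le hlt.ne ht.le).2 (by simp [t])
    have h0 : Filter.Tendsto (fun ψ => ENNReal.ofReal t * mongeKantorovich (lipNorm B μ ϑ) φ ψ) l
        (𝓝 0) := by
      have := ENNReal.Tendsto.const_mul (a := ENNReal.ofReal t)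
        (Filter.tendsto_comap (f := mongeKantorovich (lipNorm B μ ϑ) φ) (x := 𝓝 0))
        (Or.inr ENNReal.ofReal_ne_top)
      rwa [mul_zero] at this
    rw [tendsto_iff_edist_tendsto_0]
    refine tendsto_of_tendsto_of_tendsto_of_le_of_le tendsto_const_nhds h0 (fun _ => zero_le)
      fun ψ => ?_
    rw [edist_comm, edist_eq_enorm_sub]
    exact enorm_sub_le_mul φ ψ ht hat
  have h2 : ∀ n, ∀ a ∈ B n, Filter.Tendsto (fun ψ : State A => ψ a) l (𝓝 (φ a)) := by
    intro n a ha
    have hre := h1 n (realPart a) (realPart_mem ha)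
    have him := h1 n (imaginaryPart a) (imaginaryPart_mem ha)
    have e : ∀ ψ : State A, ψ a = ψ (realPart a : A) + Complex.I * ψ (imaginaryPart a : A) := by
      intro ψ
      conv_lhs => rw [← realPart_add_I_smul_imaginaryPart a]
      rw [State.apply_add, State.apply_smul]
    simp only [e]
    exact hre.add (him.const_mul _)
  rw [Metric.tendsto_nhds]
  intro ε hε
  obtain ⟨a, hxa, haB⟩ := Metric.dense_iff.1 h.dense x (ε / 3) (by positivity)
  obtain ⟨n, hn⟩ := Set.mem_iUnion.1 haB
  filter_upwards [Metric.tendsto_nhds.1 (h2 n a hn) (ε / 3) (by positivity)] with ψ hψ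
  rw [Metric.mem_ball, dist_eq_norm] at hxa
  rw [dist_eq_norm] at hψ ⊢
  have hb : ∀ χ : State A, ‖χ (a - x)‖ ≤ ‖a - x‖ := fun χ => χ.2.norm_apply_le _
  have e : ψ x - φ x = (ψ a - φ a) + (φ (a - x) - ψ (a - x)) := by
    rw [State.apply_sub, State.apply_sub]; ring
  rw [e]
  have h3 := norm_add_le (ψ a - φ a) (φ (a - x) - ψ (a - x))
  have h4 := norm_sub_le (φ (a - x)) (ψ (a - x))
  linarith [hb ψ, hb φ]

lemma metrizesWeakStar (h : IsTracialFiltration B μ) (hϑ : ∀ n, 0 < ϑ n)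
    (hlim : Filter.Tendsto ϑ Filter.atTop (𝓝 0)) :
    MetrizesWeakStar (mongeKantorovich (lipNorm B μ ϑ)) := by
  refine ⟨fun φ ψ => ?_, fun U => ⟨fun hU φ hφ => ?_, fun H => ?_⟩⟩
  -- States agree on scalars, so `μ a` may be subtracted; each state then contributes at most `ϑ 0`.
  · refine ne_top_of_le_ne_top ENNReal.ofReal_ne_top
      (mongeKantorovich_le (r := ϑ 0 + ϑ 0) fun a ha => ?_)
    have e : φ a - ψ a = φ (a - μ a • (1 : A)) - ψ (a - μ a • (1 : A)) := by
      rw [State.apply_sub_smul_one, State.apply_sub_smul_one]; ring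
    rw [e]
    have h1 := h.norm_sub_trace_le hϑ ha
    exact (norm_sub_le _ _).trans
      (add_le_add ((φ.2.norm_apply_le _).trans h1) ((ψ.2.norm_apply_le _).trans h1))
  · obtain ⟨V, hV, rfl⟩ := isOpen_induced_iff.1 hU
    have ht : Filter.Tendsto (fun ψ : State A => (ψ : A → ℂ))
        (Filter.comap (mongeKantorovich (lipNorm B μ ϑ) φ) (𝓝 0)) (𝓝 (φ : A → ℂ)) :=
      tendsto_pi_nhds.2 fun x => h.tendsto_apply φ x
    have hmem := ht (hV.mem_nhds hφ)
    obtain ⟨ε, hε, hsub⟩ := (ENNReal.nhds_zero_basis.comap _).mem_iff.1 hmem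
    exact ⟨ε, hε, fun ψ hψ => hsub hψ⟩
  · refine isOpen_iff_mem_nhds.2 fun φ hφ => ?_
    obtain ⟨ε, hε, hsub⟩ := H φ hφ
    -- One `δ` for the values on the finite net, and one for each of the two states on the error of
    -- approximation.
    obtain ⟨δ, hδ, hδε⟩ : ∃ δ : ℝ, 0 < δ ∧ ENNReal.ofReal (δ + δ + δ) < ε := by
      obtain ⟨r, hr0, hr⟩ := ENNReal.lt_iff_exists_nnreal_btwn.1 hε
      refine ⟨r / 3, by have : 0 < r := by exact_mod_cast hr0
                        positivity, ?_⟩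
      have e : (r / 3 + r / 3 + r / 3 : ℝ) = r := by ring
      rw [e, ENNReal.ofReal_coe_nnreal]
      exact hr
    obtain ⟨F, hF, hnet⟩ := h.exists_finite_net hϑ hlim hδ
    have hev : ∀ᶠ ψ : State A in 𝓝 φ, ∀ x ∈ F, ‖φ x - ψ x‖ < δ := by
      refine (Filter.eventually_all_finite hF).2 fun x _ => ?_
      have hc : Continuous fun ψ : State A => ‖φ x - ψ x‖ := by
        have : Continuous fun ψ : State A => ψ x :=
          (continuous_apply x).comp continuous_induced_dom
        fun_prop
      have := hc.tendsto φ
      rw [sub_self, norm_zero] at this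
      exact this.eventually (gt_mem_nhds hδ)
    filter_upwards [hev] with ψ hψ
    refine hsub ψ (lt_of_le_of_lt (mongeKantorovich_le fun a ha => ?_) hδε)
    obtain ⟨x, hx, c, hc⟩ := hnet a ha
    have e : φ a - ψ a = φ x - ψ x + φ (a - c • (1 : A) - x) - ψ (a - c • (1 : A) - x) := by
      rw [State.apply_sub, State.apply_sub ψ, State.apply_sub_smul_one,
        State.apply_sub_smul_one]; ring
    rw [e]
    exact (norm_sub_le _ _).trans (add_le_add ((norm_add_le _ _).trans
      (add_le_add (hψ x hx).le ((φ.2.norm_apply_le _).trans hc))) ((ψ.2.norm_apply_le _).trans hc))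

lemma lowerSemicontinuous_lipNorm : LowerSemicontinuous (lipNorm B μ ϑ) := by
  refine lowerSemicontinuous_iSup fun n => Continuous.lowerSemicontinuous ?_
  exact ENNReal.continuous_ofReal.comp (by fun_prop)

theorem isQuasiLeibnizQCMS (h : IsTracialFiltration B μ) (hϑ : ∀ n, 0 < ϑ n)
    (hlim : Filter.Tendsto ϑ Filter.atTop (𝓝 0)) :
    IsQuasiLeibnizQCMS 2 0 { carrier := A, L := lipNorm B μ ϑ } where
  add_le := lipNorm_add_le hϑ
  smul_eq := lipNorm_smul
  dense_domain := h.dense_lipNorm_lt_top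
  eq_zero_iff := h.lipNorm_eq_zero_iff hϑ
  quasi_leibniz a b _ _ := by
    simp only [ENNReal.coe_zero, zero_mul, add_zero, ENNReal.coe_ofNat]
    refine max_le (h.lipNorm_half_smul_le hϑ a b _ fun n => ?_)
      (h.lipNorm_half_smul_le hϑ a b _ fun n => ?_)
    · simp only [jordanProduct]
      rw [map_smul, ← smul_sub, norm_smul, map_add, add_sub_add_comm]
      refine mul_le_mul (by simp) (norm_add_le _ _) (norm_nonneg _) (by norm_num)
    · simp only [lieProduct]
      rw [map_smul, ← smul_sub, norm_smul, map_sub, sub_sub_sub_comm]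
      refine mul_le_mul (by simp) (norm_sub_le _ _) (norm_nonneg _) (by norm_num)
  metrizes := h.metrizesWeakStar hϑ hlim
  lowerSemicontinuous := lowerSemicontinuous_lipNorm

end IsTracialFiltration

end Filtration

/-! ### Maps out of inductive limits -/

section InductiveLimit

variable {I : CStarInductiveSequence}

namespace IsCStarInductiveLimit

variable {A : Type} [CStarAlgebra A] {ι : ∀ n, I.obj n →⋆ₐ[ℂ] A}

lemma ι_transition (h : IsCStarInductiveLimit I ι) {n m : ℕ} (hnm : n ≤ m) (a : I.obj n) :
    ι m (I.transition hnm a) = ι n a := by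
  induction m, hnm using Nat.le_induction with
  | base => rw [CStarInductiveSequence.transition_self]; rfl
  | succ m hm ih =>
    rw [CStarInductiveSequence.transition_succ hm]
    exact (h.compatible m _).trans ih

lemma range_mono (h : IsCStarInductiveLimit I ι) : Monotone fun n => (ι n).range := by
  rintro n m hnm _ ⟨a, rfl⟩
  exact ⟨I.transition hnm a, h.ι_transition hnm a⟩

lemma induction (h : IsCStarInductiveLimit I ι) {p : A → Prop} (hp : IsClosed {x | p x})
    (hι : ∀ n a, p (ι n a)) (x : A) : p x := by
  have hsub : (⋃ n, Set.range (ι n)) ⊆ {x | p x} :=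
    Set.iUnion_subset fun n => by rintro _ ⟨a, rfl⟩; exact hι n a
  exact hp.closure_subset_iff.2 hsub (h.dense x)

lemma isTracialState (h : IsCStarInductiveLimit I ι) {μ : A →ₗ[ℂ] ℂ} (hc : Continuous μ)
    (hμ : ∀ n, IsTracialState (μ ∘ₗ (ι n).toAlgHom.toLinearMap)) : IsTracialState μ := by
  have hμ1 : ∀ n a b, μ (ι n (a * b)) = μ (ι n (b * a)) := fun n a b => (hμ n).2 a b
  have hμ0 : ∀ n a, 0 ≤ μ (ι n (star a * a)) := fun n a => (hμ n).1.2 a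
  refine ⟨⟨?_, ?_⟩, fun a b => ?_⟩
  · have h1 : μ (ι 0 1) = 1 := (hμ 0).1.1
    rwa [map_one] at h1
  · refine h.induction (p := fun a => 0 ≤ μ (star a * a))
      (isClosed_le continuous_const (by fun_prop)) fun n a => ?_
    have := hμ0 n a
    rwa [map_mul, map_star] at this
  · refine h.induction (p := fun a => μ (a * b) = μ (b * a))
      (isClosed_eq (by fun_prop) (by fun_prop)) (fun n a => ?_) a
    refine h.induction (p := fun b => μ (ι n a * b) = μ (b * ι n a))
      (isClosed_eq (by fun_prop) (by fun_prop)) (fun m b => ?_) b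
    -- Two elements of different stages are compared in a common later stage.
    have := hμ1 (max n m) (I.transition (le_max_left n m) a) (I.transition (le_max_right n m) b)
    rwa [map_mul (ι _), map_mul (ι _), h.ι_transition, h.ι_transition] at this

/-- A tracial state on an inductive limit that is faithful on every term is faithful: its GNS
representation is isometric on every term, hence isometric. -/
theorem isFaithful (h : IsCStarInductiveLimit I ι) {μ : A →ₗ[ℂ] ℂ} (hμ : IsTracialState μ)
    (hf : ∀ n, IsFaithful (μ ∘ₗ (ι n).toAlgHom.toLinearMap)) : IsFaithful μ := by
  intro a ha
  let := CStarAlgebra.spectralOrder A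
  have := CStarAlgebra.spectralOrderedRing A
  set f := positiveFunctional hμ.1
  have hfa : ∀ x, f x = μ x := fun x => rfl
  set π := f.gnsStarAlgHom
  have hπ : ∀ x y : A, π x (f.toPreGNS y) = (f.toPreGNS (x * y) : f.GNS) := fun x y => by
    exact PositiveLinearMap.gnsNonUnitalStarAlgHom_apply_coe f
  have hnorm : ∀ x, ‖((f.toPreGNS x : f.PreGNS) : f.GNS)‖ ^ 2 = (μ (star x * x)).re := fun x => by
    rw [UniformSpace.Completion.norm_coe, PositiveLinearMap.preGNS_norm_def, Real.sq_sqrt]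
    · rfl
    · exact (hμ.1.2 x).1
  -- The class of `1` separates: its image under `π (ι n x)` has squared norm `μ (ι n (star x *
  -- x))`, which vanishes only for `x = 0`.
  have hinj : ∀ n, Function.Injective (π.comp (ι n)) := fun n => by
    refine (injective_iff_map_eq_zero _).2 fun x hx => ?_
    have h1 : π (ι n x) (f.toPreGNS 1) = 0 := by
      have : π (ι n x) = 0 := hx
      rw [this]; rfl
    rw [hπ, mul_one] at h1
    have h2 := hnorm (ι n x)
    rw [h1, norm_zero] at h2
    have h3 : 0 ≤ μ (ι n (star x * x)) := by
      rw [map_mul, map_star]; exact hμ.1.2 _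
    refine hf n x (Complex.ext ?_ h3.2.symm)
    change (μ (ι n (star x * x))).re = 0
    rw [map_mul, map_star, ← h2]
    norm_num
  have hiso : ‖π a‖ = ‖a‖ := by
    have hπc : Continuous π := AddMonoidHomClass.continuous_of_bound π 1 fun x => by
      rw [one_mul]; exact NonUnitalStarAlgHom.norm_apply_le π x
    refine h.induction (p := fun x => ‖π x‖ = ‖x‖) (isClosed_eq (by fun_prop) (by fun_prop))
      (fun n x => ?_) a
    rw [NonUnitalStarAlgHom.norm_map (ι n) (h.injective n) x]
    exact NonUnitalStarAlgHom.norm_map (π.comp (ι n)) (hinj n) x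
  -- Traciality turns the squared norm of `a * y` into `μ (star a * a * y * star y)`, the inner
  -- product of `a` with `a * (y * star y)`, which Cauchy–Schwarz kills because `a` is a null
  -- vector.
  have hzero : π a = 0 := by
    ext z
    induction z using UniformSpace.Completion.induction_on with
    | hp => exact isClosed_eq (by fun_prop) (by fun_prop)
    | ih z =>
      obtain ⟨y, rfl⟩ : ∃ y, f.toPreGNS y = z := ⟨_, f.toPreGNS_ofPreGNS z⟩
      rw [hπ, zero_apply, ← norm_eq_zero, ← sq_eq_zero_iff, hnorm]
      have h1 : star (a * y) * (a * y) = star y * (star a * a * y) := by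
        simp only [star_mul, mul_assoc]
      rw [h1, hμ.2, mul_assoc]
      have h2 := norm_inner_le_norm (𝕜 := ℂ) (f.toPreGNS a) (f.toPreGNS (a * (y * star y)))
      rw [PositiveLinearMap.preGNS_inner_def, PositiveLinearMap.preGNS_norm_def] at h2
      simp only [PositiveLinearMap.ofPreGNS_toPreGNS, hfa, ha, Complex.zero_re, Real.sqrt_zero,
        zero_mul] at h2
      have h3 := norm_le_zero_iff.1 h2
      rw [← mul_assoc] at h3
      rw [h3, Complex.zero_re]
  rw [← norm_eq_zero, ← hiso, hzero, norm_zero]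

lemma isTracialFiltration (h : IsCStarInductiveLimit I ι) {μ : A →ₗ[ℂ] ℂ}
    (hfin : ∀ n, FiniteDimensional ℂ (I.obj n)) (h0 : Module.finrank ℂ (I.obj 0) = 1)
    (hμ : IsTracialState μ) (hf : IsFaithful μ) :
    IsTracialFiltration (fun n => (ι n).range) μ where
  tracial := hμ
  faithful := hf
  finite n :=
    have := hfin n
    inferInstanceAs (FiniteDimensional ℂ (LinearMap.range (ι n).toAlgHom.toLinearMap))
  mono := h.range_mono
  dense := h.dense
  scalar := by
    rintro _ ⟨a, rfl⟩
    have : Nontrivial (I.obj 0) := Module.nontrivial_of_finrank_pos (R := ℂ) (by omega)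
    obtain ⟨c, hc⟩ := (finrank_eq_one_iff_of_nonzero' (1 : I.obj 0) one_ne_zero).1 h0 a
    refine ⟨c, ?_⟩
    rw [← hc]
    simp

end IsCStarInductiveLimit

namespace CStarInductiveSequence

/-- Contractive linear maps out of the terms that are compatible with the connecting maps extend to
the limit. -/
theorem Limit.exists_linear_lift {F : Type} [NormedAddCommGroup F] [NormedSpace ℂ F]
    [CompleteSpace F] (f : ∀ n, I.obj n →ₗ[ℂ] F) (hcomp : ∀ n a, f (n + 1) (I.map n a) = f n a)
    (hf : ∀ n a, ‖f n a‖ ≤ ‖a‖) : ∃ g : I.Limit →L[ℂ] F, ∀ n a, g (I.ι n a) = f n a := by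
  have hex : ∀ x : I.PreLimit, ∃ v, ∀ᶠ n in Filter.atTop, f n (x.term n) = v := fun x => by
    obtain ⟨N, hN⟩ := x.eventually_coherent
    refine ⟨f N (x.term N), Filter.eventually_atTop.2 ⟨N, fun n hn => ?_⟩⟩
    induction n, hn using Nat.le_induction with
    | base => rfl
    | succ n hn ih => rw [hN n hn, hcomp, ih]
  choose g hg using hex
  have huniq : ∀ x v, (∀ᶠ n in Filter.atTop, f n (x.term n) = v) → g x = v := fun x v hv => by
    obtain ⟨n, h1, h2⟩ := ((hg x).and hv).exists
    rw [← h1, h2]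
  let G : I.PreLimit →ₗ[ℂ] F :=
    { toFun := g
      map_add' := fun x y => huniq _ _ (by
        filter_upwards [hg x, hg y] with n hx hy
        rw [← hx, ← hy, ← map_add]; rfl)
      map_smul' := fun c x => huniq _ _ (by
        filter_upwards [hg x] with n hx
        rw [← hx, RingHom.id_apply, ← map_smul]; rfl) }
  let e : I.PreLimit →ₗ[ℂ] I.Limit :=
    { toFun := Limit.mk
      map_add' := Limit.mk_add
      map_smul' := Limit.mk_smul }
  refine ⟨G.extendOfNorm e, fun n a => ?_⟩
  have h1 : G.extendOfNorm e (e (push n a)) = G (push n a) := by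
    refine LinearMap.extendOfNorm_eq Limit.denseRange_mk ⟨1, fun x => ?_⟩ _
    obtain ⟨n, h1, h2⟩ := ((hg x).and x.norm_eventually).exists
    change ‖g x‖ ≤ 1 * ‖Limit.mk x‖
    rw [Limit.norm_mk, ← h1, ← h2, one_mul]
    exact hf n _
  refine h1.trans (huniq _ _ (Filter.eventually_atTop.2 ⟨n, fun m hm => ?_⟩))
  rw [push_term hm]
  induction m, hm using Nat.le_induction with
  | base => rw [transition_self]; rfl
  | succ m hm ih =>
    rw [transition_succ hm]
    exact (hcomp m _).trans ih

/-- The universal property of the inductive limit. -/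
theorem Limit.exists_lift {C : Type} [CStarAlgebra C] (f : ∀ n, I.obj n →⋆ₐ[ℂ] C)
    (hcomp : ∀ n a, f (n + 1) (I.map n a) = f n a) :
    ∃ g : I.Limit →⋆ₐ[ℂ] C, ∀ n a, g (I.ι n a) = f n a := by
  have hI := I.isCStarInductiveLimit
  obtain ⟨g, hg⟩ := Limit.exists_linear_lift (fun n => (f n).toAlgHom.toLinearMap) hcomp
    fun n a => NonUnitalStarAlgHom.norm_apply_le (f n) a
  have hg' : ∀ n a, g (I.ι n a) = f n a := hg
  have hone : g 1 = 1 := by rw [← map_one (I.ι 0), hg', map_one]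
  have hmul : ∀ x y, g (x * y) = g x * g y := fun x y => by
    refine hI.induction (p := fun x => g (x * y) = g x * g y)
      (isClosed_eq (by fun_prop) (by fun_prop)) (fun n a => ?_) x
    refine hI.induction (p := fun y => g (I.ι n a * y) = g (I.ι n a) * g y)
      (isClosed_eq (by fun_prop) (by fun_prop)) (fun m b => ?_) y
    rw [← hI.ι_transition (le_max_left n m) a, ← hI.ι_transition (le_max_right n m) b, ← map_mul,
      hg', hg', hg', map_mul]
  have hstar : ∀ x, g (star x) = star (g x) := fun x => by
    refine hI.induction (p := fun x => g (star x) = star (g x))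
      (isClosed_eq (by fun_prop) (by fun_prop)) (fun n a => ?_) x
    rw [← map_star, hg', hg', map_star]
  refine ⟨{ toFun := g
            map_one' := hone
            map_mul' := hmul
            map_zero' := map_zero g
            map_add' := map_add g
            commutes' := fun c => by
              rw [Algebra.algebraMap_eq_smul_one, map_smul, hone, Algebra.algebraMap_eq_smul_one]
            map_star' := hstar }, hg'⟩

end CStarInductiveSequence

end InductiveLimit

/-! ### The trace of a UHF algebra -/

section Trace

/-- The normalized trace of a full matrix algebra. -/
def normalizedTrace (d : ℕ) : Matrix (Fin d) (Fin d) ℂ →ₗ[ℂ] ℂ :=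
  (d : ℂ)⁻¹ • Matrix.traceLinearMap (Fin d) ℂ ℂ

lemma normalizedTrace_apply {d : ℕ} (a : Matrix (Fin d) (Fin d) ℂ) :
    normalizedTrace d a = (d : ℂ)⁻¹ * a.trace := rfl

lemma isTracialState_normalizedTrace {d : ℕ} (hd : 0 < d) : IsTracialState (normalizedTrace d) := by
  have hd' : (d : ℂ) ≠ 0 := by exact_mod_cast hd.ne'
  refine ⟨⟨?_, fun a => ?_⟩, fun a b => ?_⟩
  · rw [normalizedTrace_apply, Matrix.trace_one, Fintype.card_fin, inv_mul_cancel₀ hd']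
  · rw [normalizedTrace_apply]
    refine mul_nonneg ?_ (Matrix.posSemidef_conjTranspose_mul_self a).trace_nonneg
    rw [inv_nonneg]
    exact_mod_cast hd.le
  · rw [normalizedTrace_apply, normalizedTrace_apply, Matrix.trace_mul_comm]

lemma isFaithful_normalizedTrace {d : ℕ} : IsFaithful (normalizedTrace d) := by
  intro a ha
  rw [normalizedTrace_apply] at ha
  rcases Nat.eq_zero_or_pos d with rfl | hd
  · exact Subsingleton.elim _ _
  · have hd' : (d : ℂ) ≠ 0 := by exact_mod_cast hd.ne'
    exact Matrix.trace_conjTranspose_mul_self_eq_zero_iff.1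
      ((mul_eq_zero.1 ha).resolve_left (inv_ne_zero hd'))

/-- Off-diagonal matrix units are killed by the trace property, and diagonal ones have equal values,
being products of the same two matrix units in opposite orders. -/
lemma eq_normalizedTrace {d : ℕ} {φ : Matrix (Fin d) (Fin d) ℂ →ₗ[ℂ] ℂ} (hφ : IsTracialState φ) :
    φ = normalizedTrace d := by
  have hoff : ∀ i j, i ≠ j → φ (Matrix.single i j 1) = 0 := fun i j hij => by
    have h := hφ.2 (Matrix.single i i 1) (Matrix.single i j 1)
    rwa [Matrix.single_mul_single_same, Matrix.single_mul_single_of_ne _ _ _ _ hij.symm, map_zero,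
      mul_one] at h
  have hdiag : ∀ i j, φ (Matrix.single i i 1) = φ (Matrix.single j j 1) := fun i j => by
    have h := hφ.2 (Matrix.single i j 1) (Matrix.single j i 1)
    rwa [Matrix.single_mul_single_same, Matrix.single_mul_single_same, mul_one] at h
  have hsum : ∑ i, φ (Matrix.single i i 1) = 1 := by
    have h : ∑ i : Fin d, Matrix.single i i (1 : ℂ) = 1 := Matrix.sum_single_one
    rw [← map_sum, h, hφ.1.1]
  have hval : ∀ i, φ (Matrix.single i i 1) = (d : ℂ)⁻¹ := fun i => by
    rw [Finset.sum_congr rfl fun j _ => hdiag j i] at hsum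
    simp only [Finset.sum_const, Finset.card_univ, Fintype.card_fin, nsmul_eq_mul] at hsum
    exact eq_inv_of_mul_eq_one_right hsum
  refine Matrix.ext_linearMap _ fun i j => LinearMap.ext_ring ?_
  simp only [LinearMap.comp_apply, Matrix.singleLinearMap,
    normalizedTrace_apply]
  by_cases hij : i = j
  · subst hij
    simp [hval]
  · simp [hoff i j hij, Matrix.trace_single_eq_of_ne _ _ _ hij]

lemma trace_diagEmbedding (m d : ℕ) (a : Matrix (Fin d) (Fin d) ℂ) :
    (diagEmbedding m d a).trace = m * a.trace := by
  simp only [Matrix.trace, Matrix.diag_apply, diagEmbedding_apply, if_true]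
  rw [← finProdFinEquiv.sum_comp, Fintype.sum_prod_type]
  have h2 : ∀ p : Fin m × Fin d, (finProdFinEquiv p).modNat = p.2 := fun p =>
    congrArg Prod.snd (finProdFinEquiv.symm_apply_apply p)
  simp [h2]

lemma normalizedTrace_diagEmbedding {m : ℕ} (hm : 0 < m) (d : ℕ) (a : Matrix (Fin d) (Fin d) ℂ) :
    normalizedTrace (m * d) (diagEmbedding m d a) = normalizedTrace d a := by
  have hm' : (m : ℂ) ≠ 0 := Nat.cast_ne_zero.2 hm.ne'
  rw [normalizedTrace_apply, normalizedTrace_apply, trace_diagEmbedding, Nat.cast_mul, mul_inv,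
    mul_mul_mul_comm, inv_mul_cancel₀ hm', one_mul]

lemma boxProd_pos (β : ℕ → ℕ+) (n : ℕ) : 0 < boxProd β n := by
  rw [boxProd_eq_prod]
  exact Finset.prod_pos fun _ _ => Nat.succ_pos _

/-- Since `β j ≥ 1`, every factor is at least `2`; this is what matches the base `2` of the Baire
metric. -/
lemma two_pow_le_boxProd (β : ℕ → ℕ+) (n : ℕ) : 2 ^ n ≤ boxProd β n := by
  rw [boxProd_eq_prod]
  have h := Finset.prod_le_prod (s := Finset.range n) (f := fun _ => 2)
    (g := fun j => (β j : ℕ) + 1) (fun _ _ => by norm_num) fun j _ => Nat.succ_le_succ (β j).pos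
  simpa using h

variable (β : ℕ → ℕ+)

instance (n : ℕ) : FiniteDimensional ℂ ((uhfSequence β).obj n) :=
  inferInstanceAs (FiniteDimensional ℂ (Matrix (Fin (boxProd β n)) (Fin (boxProd β n)) ℂ))

lemma finrank_uhfSequence (n : ℕ) : Module.finrank ℂ ((uhfSequence β).obj n) = boxProd β n ^ 2 := by
  change Module.finrank ℂ (Matrix (Fin (boxProd β n)) (Fin (boxProd β n)) ℂ) = _
  rw [Module.finrank_matrix]
  simp [pow_two]

lemma exists_isTracialState_uhfAlgebra : ∃ μ : uhfAlgebra β →ₗ[ℂ] ℂ, IsTracialState μ := by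
  obtain ⟨g, hg⟩ := CStarInductiveSequence.Limit.exists_linear_lift (I := uhfSequence β)
    (fun n => normalizedTrace (boxProd β n)) (fun n a => normalizedTrace_diagEmbedding (Nat.succ_pos _) _ a)
    (fun n a => (isTracialState_normalizedTrace (boxProd_pos β n)).1.norm_apply_le a)
  refine ⟨g.toLinearMap, (uhfSequence β).isCStarInductiveLimit.isTracialState g.continuous
    fun n => ?_⟩
  have h : g.toLinearMap ∘ₗ ((uhfSequence β).ι n).toAlgHom.toLinearMap =
      normalizedTrace (boxProd β n) := LinearMap.ext (hg n)
  rw [h]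
  exact isTracialState_normalizedTrace (boxProd_pos β n)

lemma isTracialState_uhfTrace : IsTracialState (uhfTrace β) := by
  rw [uhfTrace, dif_pos (exists_isTracialState_uhfAlgebra β)]
  exact (exists_isTracialState_uhfAlgebra β).choose_spec

variable {β}

lemma IsTracialState.comp {A B : Type} [CStarAlgebra A] [CStarAlgebra B] {μ : B →ₗ[ℂ] ℂ}
    (hμ : IsTracialState μ) (π : A →⋆ₐ[ℂ] B) : IsTracialState (μ ∘ₗ π.toAlgHom.toLinearMap) :=
  ⟨(State.pullback π ⟨μ, hμ.1⟩).2, fun a b => by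
    change μ (π (a * b)) = μ (π (b * a))
    rw [map_mul π, map_mul π, hμ.2]⟩

lemma IsFaithful.comp {A B : Type} [CStarAlgebra A] [CStarAlgebra B] {μ : B →ₗ[ℂ] ℂ}
    (hμ : IsFaithful μ) {π : A →⋆ₐ[ℂ] B} (hπ : Function.Injective π) :
    IsFaithful (μ ∘ₗ π.toAlgHom.toLinearMap) := fun a ha => by
  refine (map_eq_zero_iff π hπ).1 (hμ _ ?_)
  rw [← map_star, ← map_mul]
  exact ha

lemma trace_uhf_apply {μ : uhfAlgebra β →ₗ[ℂ] ℂ} (hμ : IsTracialState μ) (n : ℕ)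
    (a : Matrix (Fin (boxProd β n)) (Fin (boxProd β n)) ℂ) :
    μ ((uhfSequence β).ι n a) = normalizedTrace (boxProd β n) a :=
  DFunLike.congr_fun (eq_normalizedTrace (hμ.comp ((uhfSequence β).ι n))) a

lemma eq_uhfTrace {μ : uhfAlgebra β →ₗ[ℂ] ℂ} (hμ : IsTracialState μ) : μ = uhfTrace β := by
  have hν := isTracialState_uhfTrace β
  refine LinearMap.ext ((uhfSequence β).isCStarInductiveLimit.induction
    (isClosed_eq hμ.1.continuous hν.1.continuous) fun n a => ?_)
  exact (trace_uhf_apply hμ n a).trans (trace_uhf_apply hν n a).symm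

variable (β)

lemma isFaithful_uhfTrace : IsFaithful (uhfTrace β) := by
  refine (uhfSequence β).isCStarInductiveLimit.isFaithful (isTracialState_uhfTrace β) fun n => ?_
  have h := eq_normalizedTrace ((isTracialState_uhfTrace β).comp ((uhfSequence β).ι n))
  rw [h]
  exact isFaithful_normalizedTrace

lemma isTracialFiltration_uhf : IsTracialFiltration (uhfStage β) (uhfTrace β) :=
  (uhfSequence β).isCStarInductiveLimit.isTracialFiltration (fun n => inferInstance)
    (by rw [finrank_uhfSequence]; rfl) (isTracialState_uhfTrace β) (isFaithful_uhfTrace β)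

lemma not_finiteDimensional_uhfAlgebra : ¬ FiniteDimensional ℂ (uhfAlgebra β) := by
  intro h
  -- The stage numbered by the supposed dimension already has dimension at least `2 ^ N > N`.
  set N := Module.finrank ℂ (uhfAlgebra β)
  have h1 : _ ≤ N := LinearMap.finrank_le_finrank_of_injective
    (f := ((uhfSequence β).ι N).toAlgHom.toLinearMap)
    ((uhfSequence β).isCStarInductiveLimit.injective N)
  rw [finrank_uhfSequence] at h1
  have h2 := two_pow_le_boxProd β N
  have h3 : N < 2 ^ N := Nat.lt_two_pow_self
  have h4 : boxProd β N ≤ boxProd β N ^ 2 := Nat.le_self_pow two_ne_zero _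
  omega

theorem uhfAlgebra_trace_and_expectations :
    (∃! μ : uhfAlgebra β →ₗ[ℂ] ℂ, IsTracialState μ) ∧
      IsTracialState (uhfTrace β) ∧ IsFaithful (uhfTrace β) ∧
      ∀ n, ∃! E : uhfAlgebra β →L[ℂ] uhfAlgebra β,
        IsPreservingExpectation (uhfTrace β) (uhfStage β n) E := by
  have hμ := isTracialState_uhfTrace β
  have hf := isFaithful_uhfTrace β
  refine ⟨⟨_, hμ, fun μ h => eq_uhfTrace h⟩, hμ, hf, fun n => ?_⟩
  have := (isTracialFiltration_uhf β).finite n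
  obtain ⟨E, hE⟩ := exists_isPreservingExpectation hμ hf (uhfStage β n)
  exact ⟨E, hE, fun F hF => hF.unique hμ hf hE⟩

end Trace

/-! ### Bridges with trivial pivot -/

section TrivialPivot

lemma mongeKantorovich_self {A : Type} [CStarAlgebra A] (L : selfAdjoint A → ℝ≥0∞) (φ : State A) :
    mongeKantorovich L φ φ = 0 := by
  simp [mongeKantorovich]

lemma levelSet_one (D : Type) [CStarAlgebra D] : levelSet (1 : D) = Set.univ :=
  Set.eq_univ_of_forall fun φ => by
    simp [levelSet]

lemma hausdorff_univ_of_eq_univ {T : Type} {d : T → T → ℝ≥0∞} (hd : ∀ x, d x x = 0) {S : Set T}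
    (hS : S = Set.univ) : hausdorff d Set.univ S = 0 := by
  subst hS
  refine le_antisymm (max_le ?_ ?_) zero_le <;>
  exact iSup₂_le fun x hx => (iInf₂_le x hx).trans (hd x).le

/-- With pivot `1` the level set is the whole state space, so the height vanishes as soon as states
extend along both embeddings, and only the reach remains. -/
theorem exists_bridge_length_le {X Y : LipPair} {D : Type} [CStarAlgebra D]
    {l : X.carrier →⋆ₐ[ℂ] D} {r : Y.carrier →⋆ₐ[ℂ] D} (hl : Function.Injective l)
    (hr : Function.Injective r) (hls : Function.Surjective (State.pullback l))
    (hrs : Function.Surjective (State.pullback r))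
    (hY : ∀ b, Y.L (-b) = Y.L b) (φ : State D) {ε : ℝ≥0∞}
    (hXY : ∀ a, X.L a ≤ 1 → ∃ b, Y.L b ≤ 1 ∧ ‖l a - r b‖ₑ ≤ ε)
    (hYX : ∀ b, Y.L b ≤ 1 → ∃ a, X.L a ≤ 1 ∧ ‖l a - r b‖ₑ ≤ ε) :
    ∃ γ : Bridge X.carrier Y.carrier, γ.length ≤ ε := by
  let γ : Bridge X.carrier Y.carrier :=
    { D := D
      left := l
      right := r
      left_injective := hl
      right_injective := hr
      pivot := 1
      levelSet_nonempty := ⟨φ, by rw [levelSet_one]; trivial⟩ }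
  -- The difference of `(a, 0)` and `(0, b)` has second entry `-b`, so the partner of `a` in the
  -- second unit ball must be taken with the opposite sign; `hY` allows this.
  have hs : ∀ a b, γ.seminorm ((a, 0) - (0, b)) = ‖l a - r (-b)‖ₑ := fun a b => by
    simp [Bridge.seminorm, γ]
  refine ⟨γ, max_le (max_le ?_ ?_) (max_le ?_ ?_)⟩
  · refine (hausdorff_univ_of_eq_univ (mongeKantorovich_self _) ?_).trans_le zero_le
    change State.pullback l '' levelSet 1 = Set.univ
    rw [levelSet_one, Set.image_univ, hls.range_eq]
  · refine (hausdorff_univ_of_eq_univ (mongeKantorovich_self _) ?_).trans_le zero_le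
    change State.pullback r '' levelSet 1 = Set.univ
    rw [levelSet_one, Set.image_univ, hrs.range_eq]
  · refine iSup₂_le ?_
    rintro _ ⟨a, ha, rfl⟩
    obtain ⟨b, hb, hab⟩ := hXY a ha
    refine (iInf₂_le _ ⟨-b, (hY b).trans_le hb, rfl⟩).trans ?_
    refine (hs a (-b)).trans_le ?_
    rwa [neg_neg]
  · refine iSup₂_le ?_
    rintro _ ⟨b, hb, rfl⟩
    obtain ⟨a, ha, hab⟩ := hYX (-b) ((hY b).trans_le hb)
    refine (iInf₂_le _ ⟨a, ha, rfl⟩).trans ?_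
    exact (hs a b).trans_le hab

lemma surjective_pullback_id {A : Type} [CStarAlgebra A] :
    Function.Surjective (State.pullback (StarAlgHom.id ℂ A)) := fun φ => ⟨φ, rfl⟩

end TrivialPivot

/-! ### The stages of a tracial filtration -/

section Stage

variable {A Z : Type} [CStarAlgebra A] [CStarAlgebra Z] {B : ℕ → StarSubalgebra ℂ A}
  {μ : A →ₗ[ℂ] ℂ} {ϑ ϑ' : ℕ → ℝ} {j : Z →⋆ₐ[ℂ] A} {N : ℕ}

lemma lipNorm_neg (B : ℕ → StarSubalgebra ℂ A) (μ : A →ₗ[ℂ] ℂ) (ϑ : ℕ → ℝ) (a : selfAdjoint A) :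
    lipNorm B μ ϑ (-a) = lipNorm B μ ϑ a := by
  have h := IsTracialFiltration.lipNorm_smul (B := B) (μ := μ) (ϑ := ϑ) (-1) a
  simpa using h

namespace IsTracialFiltration

lemma map_comap_of_le (h : IsTracialFiltration B μ) (hN : j.range = B N) {n : ℕ} (hn : n ≤ N) :
    ((B n).comap j).map j = B n := by
  refine le_antisymm ?_ fun x hx => ?_
  · rintro _ ⟨z, hz, rfl⟩
    exact hz
  · have hxN : x ∈ j.range := hN ▸ h.mono hn hx
    obtain ⟨z, rfl⟩ := hxN
    exact ⟨z, hx, rfl⟩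

lemma apply_mem_of_ge (h : IsTracialFiltration B μ) (hN : j.range = B N) {n : ℕ} (hn : N ≤ n)
    (z : Z) : j z ∈ B n :=
  h.mono hn (hN ▸ ⟨z, rfl⟩ : j z ∈ B N)

lemma mem_comap_of_ge (h : IsTracialFiltration B μ) (hN : j.range = B N) {n : ℕ} (hn : N ≤ n)
    (z : Z) : z ∈ (B n).comap j :=
  h.apply_mem_of_ge hN hn z

lemma comap (h : IsTracialFiltration B μ) (hj : Function.Injective j) (hN : j.range = B N) :
    IsTracialFiltration (fun n => (B n).comap j) (μ ∘ₗ j.toAlgHom.toLinearMap) where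
  tracial := h.tracial.comp j
  faithful := h.faithful.comp hj
  finite n := by
    have := h.finite n
    let f : (B n).comap j →ₗ[ℂ] B n :=
      { toFun := fun z => ⟨j z, z.2⟩
        map_add' := fun x y => Subtype.ext (map_add j x.1 y.1)
        map_smul' := fun c x => Subtype.ext (map_smul j c x.1) }
    exact FiniteDimensional.of_injective f fun x y hxy => Subtype.ext (hj (congrArg Subtype.val hxy))
  mono _ _ hnm _ hz := h.mono hnm hz
  dense := by
    have he : (⋃ n, ((B n).comap j : Set Z)) = Set.univ :=
      Set.eq_univ_of_forall fun z => Set.mem_iUnion.2 ⟨N, h.mem_comap_of_ge hN le_rfl z⟩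
    rw [he]
    exact dense_univ
  scalar z hz := by
    obtain ⟨c, hc⟩ := h.scalar (j z) hz
    exact ⟨c, hj (by rw [hc, map_smul, map_one])⟩

/-- Expectations commute with `j` up to stage `N`, and from `N` on every term vanishes on the image
of `j`. Hence only the weights up to `N` matter, which lets two different weight sequences induce
the same Lip-norm. -/
lemma lipNorm_comap (h : IsTracialFiltration B μ) (hj : Function.Injective j)
    (hN : j.range = B N) (hϑ : ∀ n ≤ N, ϑ' n = ϑ n) (z : selfAdjoint Z) (a : selfAdjoint A)
    (ha : (a : A) = j z) :
    lipNorm (fun n => (B n).comap j) (μ ∘ₗ j.toAlgHom.toLinearMap) ϑ' z = lipNorm B μ ϑ a := by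
  have h' := h.comap hj hN
  refine iSup_congr fun n => ?_
  have := h.finite n
  have := h'.finite n
  rcases le_total n N with hn | hn
  · rw [ha, condExp_map h'.tracial h'.faithful h.tracial h.faithful (fun _ => rfl)
      (h.map_comap_of_le hN hn), ← map_sub, NonUnitalStarAlgHom.norm_map j hj, hϑ n hn]
  · rw [condExp_of_mem h'.tracial h'.faithful (h.mem_comap_of_ge hN hn _), ha,
      condExp_of_mem h.tracial h.faithful (h.apply_mem_of_ge hN hn z)]
    simp

/-- States extend from a stage, by composition with the expectation. -/
lemma surjective_pullback (h : IsTracialFiltration B μ) (hj : Function.Injective j)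
    (hN : j.range = B N) : Function.Surjective (State.pullback j) := by
  intro φ
  have := h.finite N
  have hE := condExp_spec h.tracial h.faithful (B N)
  have hex : ∀ b ∈ B N, ∃ z, j z = b := fun b hb => (hN ▸ hb : b ∈ j.range)
  choose g hg using fun a => hex _ (hE.mem a)
  let G : A →ₗ[ℂ] Z :=
    { toFun := g
      map_add' := fun x y => hj (by rw [hg, map_add, map_add, hg, hg])
      map_smul' := fun c x => hj (by rw [hg, map_smul, RingHom.id_apply, map_smul, hg]) }
  have hG : ∀ z, G (j z) = z := fun z => hj ((hg _).trans
    (condExp_of_mem h.tracial h.faithful (h.apply_mem_of_ge hN le_rfl z)))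
  refine ⟨⟨φ.1 ∘ₗ G, ?_, fun a => ?_⟩, Subtype.ext (LinearMap.ext fun z => congrArg φ.1 (hG z))⟩
  · have h1 := hG 1
    rw [map_one] at h1
    rw [LinearMap.comp_apply, h1]
    exact φ.2.1
  · obtain ⟨b, hb, hbE⟩ := exists_mem_condExp_star_mul_self h.tracial h.faithful (B N) a
    obtain ⟨w, rfl⟩ := hex b hb
    have h1 : G (star a * a) = star w * w := hj ((hg _).trans (by rw [hbE, map_mul, map_star]))
    rw [LinearMap.comp_apply, h1]
    exact φ.2.2 w

/-- The witness is the expectation of `a` at stage `N`. For `n ≤ N` the two expectations commute, so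
the distance to stage `n` can only shrink; for `n ≥ N` it is zero. -/
lemma exists_stage_approx (h : IsTracialFiltration B μ) (hϑ : ∀ n, 0 < ϑ n)
    (hj : Function.Injective j) (hN : j.range = B N) {a : selfAdjoint A}
    (ha : lipNorm B μ ϑ a ≤ 1) :
    ∃ z : selfAdjoint Z, (∀ b : selfAdjoint A, (b : A) = j z → lipNorm B μ ϑ b ≤ 1) ∧
      ‖(a : A) - j z‖ ≤ ϑ N := by
  have := h.finite N
  have hE := condExp_spec h.tracial h.faithful (B N)
  have ha' := (lipNorm_le_one_iff hϑ).1 ha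
  obtain ⟨z, hz⟩ : ∃ z, j z = condExp μ (B N) a := (hN ▸ hE.mem a : condExp μ (B N) a ∈ j.range)
  have hzsa : IsSelfAdjoint z := hj (by
    rw [map_star, hz, ← condExp_star h.tracial h.faithful, selfAdjoint.star_val_eq])
  refine ⟨⟨z, hzsa⟩, fun b hb => (lipNorm_le_one_iff hϑ).2 fun n => ?_, ?_⟩
  · rw [hb]
    change ‖j z - condExp μ (B n) (j z)‖ ≤ ϑ n
    have := h.finite n
    have hEn := condExp_spec h.tracial h.faithful (B n)
    rcases le_total n N with hn | hn
    · have e1 : condExp μ (B n) (condExp μ (B N) a) = condExp μ (B n) a :=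
        condExp_eq h.tracial h.faithful (hEn.mem _) fun c hc => by
          rw [hEn.trace_mul _ hc, hE.trace_mul _ (h.mono hn hc)]
      have e2 : condExp μ (B N) (condExp μ (B n) a) = condExp μ (B n) a :=
        condExp_of_mem h.tracial h.faithful (h.mono hn (hEn.mem _))
      have e3 : condExp μ (B N) a - condExp μ (B n) a =
          condExp μ (B N) (a - condExp μ (B n) a) := by rw [map_sub, e2]
      rw [hz, e1, e3]
      exact (norm_condExp_le h.tracial h.faithful (B N) _).trans (ha' n)
    · rw [condExp_of_mem h.tracial h.faithful (h.apply_mem_of_ge hN hn z), sub_self, norm_zero]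
      exact (hϑ n).le
  · change ‖(a : A) - j z‖ ≤ ϑ N
    rw [hz]
    exact ha' N

variable {L : selfAdjoint Z → ℝ≥0∞}

/-- The bridges between an algebra and one of its stages. -/
theorem exists_stage_bridges (h : IsTracialFiltration B μ) (hϑ : ∀ n, 0 < ϑ n)
    (hj : Function.Injective j) (hN : j.range = B N)
    (hL : ∀ (z : selfAdjoint Z) (a : selfAdjoint A), (a : A) = j z → L z = lipNorm B μ ϑ a) :
    (∃ γ : Bridge A Z, Bridge.length (X := ⟨A, lipNorm B μ ϑ⟩) (Y := ⟨Z, L⟩) γ ≤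
      ENNReal.ofReal (ϑ N)) ∧
    (∃ γ : Bridge Z A, Bridge.length (X := ⟨Z, L⟩) (Y := ⟨A, lipNorm B μ ϑ⟩) γ ≤
      ENNReal.ofReal (ϑ N)) := by
  let J : selfAdjoint Z → selfAdjoint A := fun z => ⟨j z, IsSelfAdjoint.map z.2 j⟩
  have hLJ : ∀ z, L z = lipNorm B μ ϑ (J z) := fun z => hL z (J z) rfl
  have hneg : ∀ z, L (-z) = L z := fun z => by
    rw [hLJ, hLJ, ← lipNorm_neg B μ ϑ (J z)]
    congr 1
    exact Subtype.ext (map_neg j (z : Z))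
  have happ : ∀ a : selfAdjoint A, lipNorm B μ ϑ a ≤ 1 →
      ∃ z, L z ≤ 1 ∧ ‖(a : A) - j z‖ₑ ≤ ENNReal.ofReal (ϑ N) := fun a ha => by
    obtain ⟨z, hz, hn⟩ := h.exists_stage_approx hϑ hj hN ha
    refine ⟨z, (hLJ z).trans_le (hz _ rfl), ?_⟩
    rw [← ofReal_norm]
    exact ENNReal.ofReal_le_ofReal hn
  have hid : Function.Injective (StarAlgHom.id ℂ A) := fun _ _ h => h
  constructor
  · refine exists_bridge_length_le (X := ⟨A, lipNorm B μ ϑ⟩) (Y := ⟨Z, L⟩) (l := StarAlgHom.id ℂ A)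
      (r := j) hid hj surjective_pullback_id (h.surjective_pullback hj hN) hneg
      ⟨μ, h.tracial.1⟩ happ fun z hz => ⟨J z, (hLJ z).symm.trans_le hz, ?_⟩
    simp [J]
  · refine exists_bridge_length_le (X := ⟨Z, L⟩) (Y := ⟨A, lipNorm B μ ϑ⟩) (l := j)
      (r := StarAlgHom.id ℂ A) hj hid (h.surjective_pullback hj hN) surjective_pullback_id
      (lipNorm_neg B μ ϑ) ⟨μ, h.tracial.1⟩ (fun z hz => ⟨J z, (hLJ z).symm.trans_le hz, ?_⟩)
      fun a ha => ?_
    · simp [J]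
    · obtain ⟨z, hz, hn⟩ := happ a ha
      refine ⟨z, hz, ?_⟩
      rwa [← enorm_neg, neg_sub]

end IsTracialFiltration

end Stage

/-! ### The Hölder estimate -/

section Holder

/-- The identification of matrix algebras of equal size. -/
def matrixCast {d d' : ℕ} (h : d = d') :
    Matrix (Fin d) (Fin d) ℂ ≃⋆ₐ[ℂ] Matrix (Fin d') (Fin d') ℂ :=
  h ▸ StarAlgEquiv.refl ℂ _

lemma matrixCast_diagEmbedding {m m' d d' : ℕ} (hm : m = m') (hd : d = d') (h : m * d = m' * d')
    (a : Matrix (Fin d) (Fin d) ℂ) :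
    matrixCast h (diagEmbedding m d a) = diagEmbedding m' d' (matrixCast hd a) := by
  subst hm hd
  rfl

variable {β η : ℕ → ℕ+}

lemma boxProd_congr {N : ℕ} (h : ∀ n < N, β n = η n) : boxProd β N = boxProd η N := by
  rw [boxProd_eq_prod, boxProd_eq_prod]
  exact Finset.prod_congr rfl fun n hn => by rw [h n (Finset.mem_range.1 hn)]

/-- The identification of the `n`-th terms of two UHF sequences. -/
def stageCast {n : ℕ} (h : boxProd β n = boxProd η n) :
    (uhfSequence β).obj n ≃⋆ₐ[ℂ] (uhfSequence η).obj n :=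
  matrixCast h

lemma stageCast_transition {n N : ℕ} (hn : n ≤ N) (h : ∀ i < N, β i = η i)
    (x : (uhfSequence β).obj n) :
    stageCast (boxProd_congr h) ((uhfSequence β).transition hn x) =
      (uhfSequence η).transition hn
        (stageCast (boxProd_congr fun i hi => h i (hi.trans_le hn)) x) := by
  induction N, hn using Nat.le_induction with
  | base => rw [CStarInductiveSequence.transition_self, CStarInductiveSequence.transition_self]; rfl
  | succ N hn ih =>
    rw [CStarInductiveSequence.transition_succ hn, CStarInductiveSequence.transition_succ hn]
    have ih' := ih fun i hi => h i (hi.trans N.lt_succ_self)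
    have h1 : (β N + 1 : ℕ) = η N + 1 := by rw [h N N.lt_succ_self]
    refine (matrixCast_diagEmbedding h1 (boxProd_congr fun i hi => h i (hi.trans N.lt_succ_self))
      (boxProd_congr h) _).trans ?_
    exact congrArg ((uhfSequence η).map N) ih'

/-- The `N`-th term of the sequence of `β` inside the UHF algebra of `η`. -/
def crossEmbedding {N : ℕ} (h : ∀ i < N, β i = η i) :
    (uhfSequence β).obj N →⋆ₐ[ℂ] uhfAlgebra η :=
  ((uhfSequence η).ι N).comp (stageCast (boxProd_congr h)).toStarAlgHom

lemma crossEmbedding_apply {N : ℕ} (h : ∀ i < N, β i = η i) (z : (uhfSequence β).obj N) :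
    crossEmbedding h z = (uhfSequence η).ι N (stageCast (boxProd_congr h) z) := rfl

lemma crossEmbedding_injective {N : ℕ} (h : ∀ i < N, β i = η i) :
    Function.Injective (crossEmbedding h) := fun _ _ hxy =>
  (stageCast (boxProd_congr h)).injective ((uhfSequence η).isCStarInductiveLimit.injective N hxy)

lemma range_crossEmbedding {N : ℕ} (h : ∀ i < N, β i = η i) :
    (crossEmbedding h).range = uhfStage η N := by
  refine le_antisymm ?_ ?_
  · rintro _ ⟨z, rfl⟩
    exact ⟨_, rfl⟩
  · rintro _ ⟨y, rfl⟩
    refine ⟨(stageCast (boxProd_congr h)).symm y, ?_⟩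
    change (uhfSequence η).ι N (stageCast _ ((stageCast _).symm y)) = _
    rw [StarAlgEquiv.apply_symm_apply]
    rfl

/-- The `N`-th stage inherits the same filtration from both algebras: below `N` the connecting maps
coincide, and from `N` on both pullbacks are everything. -/
lemma comap_crossEmbedding {N : ℕ} (h : ∀ i < N, β i = η i) (n : ℕ) :
    (uhfStage η n).comap (crossEmbedding h) = (uhfStage β n).comap ((uhfSequence β).ι N) := by
  have hβ := (uhfSequence β).isCStarInductiveLimit
  have hη := (uhfSequence η).isCStarInductiveLimit
  rcases le_total n N with hn | hn
  · ext z
    constructor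
    · rintro ⟨y, hy⟩
      refine ⟨(stageCast (boxProd_congr fun i hi => h i (hi.trans_le hn))).symm y, ?_⟩
      have hy' : (uhfSequence η).ι n y = crossEmbedding h z := hy
      change (uhfSequence β).ι n _ = (uhfSequence β).ι N z
      rw [← hβ.ι_transition hn]
      congr 1
      apply crossEmbedding_injective h
      rw [← hy', crossEmbedding_apply, stageCast_transition hn h, StarAlgEquiv.apply_symm_apply,
        hη.ι_transition]
    · rintro ⟨x, hx⟩
      have hx' : (uhfSequence β).ι n x = (uhfSequence β).ι N z := hx
      rw [← hβ.ι_transition hn] at hx'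
      refine ⟨stageCast (boxProd_congr fun i hi => h i (hi.trans_le hn)) x, ?_⟩
      change (uhfSequence η).ι n _ = crossEmbedding h z
      rw [← hβ.injective N hx', crossEmbedding_apply, stageCast_transition hn h, hη.ι_transition]
  · ext z
    exact iff_of_true
      ((isTracialFiltration_uhf η).mem_comap_of_ge (range_crossEmbedding h) hn z)
      ((isTracialFiltration_uhf β).mem_comap_of_ge rfl hn z)

lemma trace_crossEmbedding {N : ℕ} (h : ∀ i < N, β i = η i) :
    uhfTrace η ∘ₗ (crossEmbedding h).toAlgHom.toLinearMap =
      uhfTrace β ∘ₗ ((uhfSequence β).ι N).toAlgHom.toLinearMap :=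
  (eq_normalizedTrace (d := boxProd β N) ((isTracialState_uhfTrace η).comp _)).trans
    (eq_normalizedTrace (d := boxProd β N) ((isTracialState_uhfTrace β).comp _)).symm

/-- The chain passes through the common `N`-th stage; each of its two bridges costs at most `ϑ N`.
-/
theorem propinquity_uhf_le {N : ℕ} (h : ∀ i < N, β i = η i) {ϑ ϑ' : ℕ → ℝ} (hϑ : ∀ n, 0 < ϑ n)
    (hϑ' : ∀ n, 0 < ϑ' n) (hlim : Filter.Tendsto ϑ Filter.atTop (𝓝 0))
    (hϑϑ' : ∀ n ≤ N, ϑ n = ϑ' n) :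
    propinquity 2 0 (uhf β ϑ) (uhf η ϑ') ≤ ENNReal.ofReal (2 * ϑ N) := by
  have hβ := isTracialFiltration_uhf β
  have hη := isTracialFiltration_uhf η
  have hinj := (uhfSequence β).isCStarInductiveLimit.injective N
  let Z : LipPair :=
    { carrier := (uhfSequence β).obj N
      L := lipNorm (fun n => (uhfStage β n).comap ((uhfSequence β).ι N))
        (uhfTrace β ∘ₗ ((uhfSequence β).ι N).toAlgHom.toLinearMap) ϑ }
  have hZ : IsQuasiLeibnizQCMS 2 0 Z :=
    (hβ.comap hinj (N := N) rfl).isQuasiLeibnizQCMS hϑ hlim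
  obtain ⟨⟨γ, hγ⟩, -⟩ := hβ.exists_stage_bridges (N := N) (L := Z.L) hϑ hinj rfl
    fun z a ha => hβ.lipNorm_comap hinj rfl (fun _ _ => rfl) z a ha
  obtain ⟨-, ⟨γ', hγ'⟩⟩ := hη.exists_stage_bridges (N := N) (L := Z.L) hϑ'
    (crossEmbedding_injective h) (range_crossEmbedding h) fun z a ha => by
      rw [← hη.lipNorm_comap (crossEmbedding_injective h) (range_crossEmbedding h) hϑϑ' z a ha,
        trace_crossEmbedding h]
      simp only [comap_crossEmbedding h]
      rfl
  refine (iInf_le _ (Trek.cons (X := uhf β ϑ) (Z := Z) (Y := uhf η ϑ') γ hZ (Trek.single γ'))).trans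
    ?_
  have h1 := (hϑ N).le
  rw [two_mul, ENNReal.ofReal_add h1 h1]
  refine add_le_add hγ ?_
  rw [hϑϑ' N le_rfl]
  exact hγ'

/-- Settles equal sequences, which have no first index of disagreement; the identity bridge has
length zero. -/
lemma propinquity_uhf_self (β : ℕ → ℕ+) (ϑ : ℕ → ℝ) :
    propinquity 2 0 (uhf β ϑ) (uhf β ϑ) = 0 := by
  have hid : Function.Injective (StarAlgHom.id ℂ (uhfAlgebra β)) := fun _ _ h => h
  obtain ⟨γ, hγ⟩ := exists_bridge_length_le (X := uhf β ϑ) (Y := uhf β ϑ) (ε := 0) hid hid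
    surjective_pullback_id surjective_pullback_id (lipNorm_neg _ _ _)
    ⟨_, (isTracialState_uhfTrace β).1⟩ (fun a ha => ⟨a, ha, by simp⟩) fun a ha => ⟨a, ha, by simp⟩
  exact le_antisymm ((iInf_le _ (Trek.single γ)).trans hγ) zero_le

lemma sizeWeight_pos (s : ℝ) (β : ℕ → ℕ+) (n : ℕ) : 0 < sizeWeight s β n :=
  Real.rpow_pos_of_pos (Nat.cast_pos.2 (boxProd_pos β n)) _

lemma sizeWeight_le {s : ℝ} (hs : 0 ≤ s) (β : ℕ → ℕ+) (n : ℕ) :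
    sizeWeight s β n ≤ ((2 : ℝ) ^ (-(n : ℝ))) ^ s := by
  have h : ((2 : ℝ) ^ n) ≤ boxProd β n := by exact_mod_cast two_pow_le_boxProd β n
  rw [← Real.rpow_mul zero_le_two, neg_mul, ← mul_neg, Real.rpow_mul zero_le_two, Real.rpow_natCast]
  exact Real.rpow_le_rpow_of_nonpos (by positivity) h (neg_nonpos.2 hs)

lemma tendsto_sizeWeight {s : ℝ} (hs : 0 < s) (β : ℕ → ℕ+) :
    Filter.Tendsto (sizeWeight s β) Filter.atTop (𝓝 0) := by
  refine squeeze_zero (fun n => (sizeWeight_pos s β n).le) (sizeWeight_le hs.le β) ?_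
  have h : ∀ n : ℕ, ((2 : ℝ) ^ (-(n : ℝ))) ^ s = ((2 : ℝ) ^ (-s)) ^ n := fun n => by
    rw [← Real.rpow_natCast, ← Real.rpow_mul zero_le_two, ← Real.rpow_mul zero_le_two]
    congr 1
    ring
  simp only [h]
  exact tendsto_pow_atTop_nhds_zero_of_lt_one (by positivity)
    (Real.rpow_lt_one_of_one_lt_of_neg one_lt_two (neg_neg_of_pos hs))

lemma dimWeight_eq_sizeWeight (k : ℝ) (β : ℕ → ℕ+) : dimWeight k β = sizeWeight (2 * k) β := by
  ext n
  rw [dimWeight, sizeWeight, finrank_uhfSequence, Nat.cast_pow, ← Real.rpow_natCast,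
    ← Real.rpow_mul (Nat.cast_nonneg _)]
  congr 1
  push_cast
  ring

theorem isQuasiLeibnizQCMS_uhf {s : ℝ} (hs : 0 < s) (β : ℕ → ℕ+) :
    IsQuasiLeibnizQCMS 2 0 (uhf β (sizeWeight s β)) :=
  (isTracialFiltration_uhf β).isQuasiLeibnizQCMS (sizeWeight_pos s β) (tendsto_sizeWeight hs β)

/-- `N` is the first index of disagreement, so the Baire distance is `2 ^ (-N) ≤ 1`. Raising it to a
larger exponent decreases it, so any `s ≥ k` serves, in particular both `k` and `2 * k`. -/
theorem propinquity_uhf_le_baireDist {k s : ℝ} (hk : 0 < k) (hks : k ≤ s) (β η : ℕ → ℕ+) :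
    propinquity 2 0 (uhf β (sizeWeight s β)) (uhf η (sizeWeight s η)) ≤
      ENNReal.ofReal (2 * baireDist β η ^ k) := by
  by_cases hβη : β = η
  · subst hβη
    rw [propinquity_uhf_self]
    exact zero_le
  · set N := sInf {n : ℕ | β n ≠ η n} with hN
    have h : ∀ i < N, β i = η i := fun i hi => by
      by_contra hne
      exact Nat.notMem_of_lt_sInf hi hne
    have hd : baireDist β η = (2 : ℝ) ^ (-(N : ℝ)) := if_neg hβη
    refine (propinquity_uhf_le h (sizeWeight_pos s β) (sizeWeight_pos s η)
      (tendsto_sizeWeight (hk.trans_le hks) β) fun n hn => ?_).trans ?_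
    · rw [sizeWeight, sizeWeight, boxProd_congr fun i hi => h i (hi.trans_le hn)]
    · refine ENNReal.ofReal_le_ofReal (mul_le_mul_of_nonneg_left ?_ zero_le_two)
      rw [hd]
      refine (sizeWeight_le (hk.le.trans hks) β N).trans ?_
      refine Real.rpow_le_rpow_of_exponent_ge (by positivity) ?_ hks
      exact Real.rpow_le_one_of_one_le_of_nonpos one_le_two (neg_nonpos.2 (Nat.cast_nonneg N))

theorem uhfClass_uhf (s : ℝ) (β : ℕ → ℕ+) : UHFClass (s / 2) (uhf β (sizeWeight s β)) := by
  have hβ := isTracialFiltration_uhf β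
  refine ⟨not_finiteDimensional_uhfAlgebra β, uhfSequence β, (uhfSequence β).ι, uhfTrace β,
    fun n => ⟨boxProd β n, ⟨StarAlgEquiv.refl ℂ _⟩⟩, by rw [finrank_uhfSequence]; rfl,
    (uhfSequence β).isCStarInductiveLimit, hβ.tracial, hβ.faithful, ?_⟩
  have h := dimWeight_eq_sizeWeight (s / 2) β
  rw [mul_div_cancel₀ s two_ne_zero] at h
  rw [← h]
  rfl

end Holder

/-! ### Homomorphisms between full matrix algebras -/

section MatrixHom

open Matrix

/-- The trace of an idempotent is its rank, and an orthonormal basis of its range supplies the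
vectors. -/
lemma exists_orthonormal_of_isIdempotentElem {n : ℕ} {P : Matrix (Fin n) (Fin n) ℂ}
    (hP : IsIdempotentElem P) : ∃ (m : ℕ) (v : Fin m → Fin n → ℂ), P.trace = m ∧
      (∀ r, P *ᵥ v r = v r) ∧ ∀ r s, v s ⬝ᵥ star (v r) = if r = s then 1 else 0 := by
  set T := Matrix.toLpLin 2 2 P with hT
  have hTi : IsIdempotentElem T := by
    rw [IsIdempotentElem, Module.End.mul_eq_comp, hT, ← Matrix.toLpLin_mul, hP.eq]
  have hproj := LinearMap.IsIdempotentElem.isProj_range _ hTi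
  have htr : LinearMap.trace ℂ _ T = P.trace := by
    rw [LinearMap.trace_eq_matrix_trace ℂ (PiLp.basisFun 2 ℂ (Fin n)), hT,
      Matrix.toLpLin_eq_toLin, LinearMap.toMatrix_toLin]
  let b := stdOrthonormalBasis ℂ (LinearMap.range T)
  refine ⟨_, fun r => WithLp.ofLp (b r : EuclideanSpace ℂ (Fin n)), ?_, fun r => ?_, fun r s => ?_⟩
  · rw [← htr]
    exact hproj.trace
  · exact congrArg WithLp.ofLp (hproj.map_id _ (b r).2)
  · rw [← EuclideanSpace.inner_eq_star_dotProduct, ← Submodule.coe_inner]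
    exact (orthonormal_iff_ite.1 b.orthonormal) r s

variable {d n : ℕ}

/-- The images of the `d` diagonal matrix units have equal traces and sum to the identity. As these
traces are ranks, `d` must divide `n`. -/
lemma card_mul_trace_apply_single (ψ : Matrix (Fin d) (Fin d) ℂ →⋆ₐ[ℂ] Matrix (Fin n) (Fin n) ℂ)
    (i : Fin d) : (d : ℂ) * (ψ (single i i 1)).trace = n := by
  have hdiag : ∀ j, (ψ (single j j 1)).trace = (ψ (single i i 1)).trace := fun j => by
    have h1 : single j j (1 : ℂ) = single j i 1 * single i j 1 := by
      rw [single_mul_single_same, mul_one]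
    have h2 : single i i (1 : ℂ) = single i j 1 * single j i 1 := by
      rw [single_mul_single_same, mul_one]
    rw [h1, h2, map_mul, map_mul, Matrix.trace_mul_comm]
  have hsum : ∑ j, (ψ (single j j 1)).trace = n := by
    have h : ∑ j : Fin d, single j j (1 : ℂ) = 1 := sum_single_one
    rw [← Matrix.trace_sum, ← map_sum, h, map_one, Matrix.trace_one, Fintype.card_fin]
  rw [Finset.sum_congr rfl fun j _ => hdiag j] at hsum
  simpa using hsum

lemma isIdempotentElem_apply_single (ψ : Matrix (Fin d) (Fin d) ℂ →⋆ₐ[ℂ] Matrix (Fin n) (Fin n) ℂ)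
    (i : Fin d) : IsIdempotentElem (ψ (single i i 1)) := by
  rw [IsIdempotentElem, ← map_mul, single_mul_single_same, mul_one]

lemma dvd_of_starAlgHom (ψ : Matrix (Fin d) (Fin d) ℂ →⋆ₐ[ℂ] Matrix (Fin n) (Fin n) ℂ)
    (hd : 0 < d) : d ∣ n := by
  obtain ⟨m, v, hm, -⟩ := exists_orthonormal_of_isIdempotentElem
    (isIdempotentElem_apply_single ψ ⟨0, hd⟩)
  have h := card_mul_trace_apply_single ψ ⟨0, hd⟩
  rw [hm] at h
  exact ⟨m, by exact_mod_cast h.symm⟩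

end MatrixHom

/-! ### Unitary equivalence with diagonal embeddings -/

section Unitary

open Matrix

/-- A unital *-homomorphism between full matrix algebras is unitarily equivalent to a diagonal
embedding. -/
theorem exists_unitary_conj_diagEmbedding {m d : ℕ} (hd : 0 < d)
    (ψ : Matrix (Fin d) (Fin d) ℂ →⋆ₐ[ℂ] Matrix (Fin (m * d)) (Fin (m * d)) ℂ) :
    ∃ U : unitary (Matrix (Fin (m * d)) (Fin (m * d)) ℂ),
      ∀ a, ψ a = Unitary.conjStarAlgAut ℂ _ U (diagEmbedding m d a) := by
  let o : Fin d := ⟨0, hd⟩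
  obtain ⟨m', v, hm, hv, horth⟩ := exists_orthonormal_of_isIdempotentElem
    (isIdempotentElem_apply_single ψ o)
  obtain rfl : m' = m := by
    have h := card_mul_trace_apply_single ψ o
    rw [hm] at h
    have h' : d * m' = m * d := by exact_mod_cast h
    rw [mul_comm] at h'
    exact Nat.eq_of_mul_eq_mul_right hd h'
  -- The basis adapted to `ψ`: the matrix units transport an orthonormal basis of the range of `ψ
  -- (e_oo)` to the ranges of the other diagonal projections. The block number `divNat` selects the
  -- vector and `modNat` the matrix unit, as in `diagEmbedding`.
  let w : Fin (m' * d) → Fin (m' * d) → ℂ := fun q => ψ (single q.modNat o 1) *ᵥ v q.divNat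
  let U : Matrix (Fin (m' * d)) (Fin (m' * d)) ℂ := Matrix.of fun p q => w q p
  have hstar : ∀ i, star (ψ (single i o 1)) = ψ (single o i 1) := fun i => by
    rw [← map_star]
    congr 1
    rw [star_eq_conjTranspose, conjTranspose_single, star_one]
  -- Moving one matrix unit across the inner product leaves `e_{oi} e_{i'o}`, which is `e_{oo}` if
  -- `i = i'` and zero otherwise.
  have hinner : ∀ q q', w q' ⬝ᵥ star (w q) = if q = q' then 1 else 0 := fun q q' => by
    have h1 : w q' ⬝ᵥ star (w q) =
        (ψ (single o q.modNat 1 * single q'.modNat o 1) *ᵥ v q'.divNat) ⬝ᵥ star (v q.divNat) := by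
      rw [map_mul, ← hstar, ← mulVec_mulVec, star_eq_conjTranspose]
      change w q' ⬝ᵥ star (ψ (single q.modNat o 1) *ᵥ v q.divNat) = _
      rw [star_mulVec, dotProduct_comm, ← dotProduct_mulVec, dotProduct_comm]
    have h2 : q = q' ↔ q.divNat = q'.divNat ∧ q.modNat = q'.modNat := by
      rw [← finProdFinEquiv.symm.injective.eq_iff, Prod.ext_iff]; rfl
    rw [h1]
    by_cases hmod : q.modNat = q'.modNat
    · rw [hmod, single_mul_single_same, mul_one, hv, horth]
      simp [h2, hmod]
    · rw [single_mul_single_of_ne _ _ _ _ hmod, map_zero, zero_mulVec, zero_dotProduct,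
        if_neg fun h => hmod (h2.1 h).2]
  have hUU : star U * U = 1 := by
    ext q q'
    rw [one_apply, ← hinner q q', mul_apply, dotProduct]
    exact Finset.sum_congr rfl fun p _ => mul_comm _ _
  have hcomm : ∀ a, ψ a * U = U * diagEmbedding m' d a := fun a => by
    ext p q
    have h1 : (ψ a * U) p q = (ψ (a * single q.modNat o 1) *ᵥ v q.divNat) p := by
      rw [map_mul, ← mulVec_mulVec]
      rfl
    have h2 : a * single q.modNat o 1 = ∑ i, a i q.modNat • single i o (1 : ℂ) := by
      ext i j
      rw [Matrix.sum_apply, Finset.sum_eq_single i]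
      · by_cases hj : o = j
        · subst hj; simp
        · simp [mul_apply, hj]
      · intro b _ hb
        simp [hb]
      · simp
    have h3 : ∀ r : Fin m' × Fin d, (finProdFinEquiv r).divNat = r.1 := fun r =>
      congrArg Prod.fst (finProdFinEquiv.symm_apply_apply r)
    have h4 : ∀ r : Fin m' × Fin d, (finProdFinEquiv r).modNat = r.2 := fun r =>
      congrArg Prod.snd (finProdFinEquiv.symm_apply_apply r)
    rw [h1, h2, map_sum, sum_mulVec, Finset.sum_apply, mul_apply, ← finProdFinEquiv.sum_comp,
      Fintype.sum_prod_type, Finset.sum_eq_single q.divNat]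
    · refine Finset.sum_congr rfl fun i _ => ?_
      simp only [U, w, of_apply, diagEmbedding_apply, h3, h4, if_true]
      rw [map_smul, smul_mulVec, Pi.smul_apply, smul_eq_mul, mul_comm]
    · intro b _ hb
      simp [diagEmbedding_apply, h3, hb]
    · simp
  refine ⟨⟨U, hUU, mul_eq_one_comm.1 hUU⟩, fun a => ?_⟩
  rw [Unitary.conjStarAlgAut_apply]
  change ψ a = U * diagEmbedding m' d a * star U
  rw [← hcomm, mul_assoc, mul_eq_one_comm.1 hUU, mul_one]

end Unitary

/-! ### Parametrizations of nested matrix subalgebras -/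

section Factor

variable {A : Type} [CStarAlgebra A]

lemma exists_factor {Y Z : Type} [CStarAlgebra Y] [CStarAlgebra Z] {f : Y →⋆ₐ[ℂ] A}
    {g : Z →⋆ₐ[ℂ] A} (hg : Function.Injective g) (hfg : f.range ≤ g.range) :
    ∃ ψ : Y →⋆ₐ[ℂ] Z, ∀ y, g (ψ y) = f y := by
  let e := StarAlgEquiv.ofInjective g hg
  refine ⟨e.symm.toStarAlgHom.comp (f.codRestrict g.range fun y => hfg ⟨y, rfl⟩), fun y => ?_⟩
  exact congrArg Subtype.val (e.apply_symm_apply (f.codRestrict g.range (fun y => hfg ⟨y, rfl⟩) y))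

/-- Between nested matrix subalgebras, parametrizations can be chosen compatible with the diagonal
embedding. -/
lemma exists_extension_diagEmbedding {m d : ℕ} (hd : 0 < d)
    {f : Matrix (Fin d) (Fin d) ℂ →⋆ₐ[ℂ] A}
    {g : Matrix (Fin (m * d)) (Fin (m * d)) ℂ →⋆ₐ[ℂ] A} (hg : Function.Injective g)
    (hfg : f.range ≤ g.range) :
    ∃ g' : Matrix (Fin (m * d)) (Fin (m * d)) ℂ →⋆ₐ[ℂ] A, Function.Injective g' ∧
      g'.range = g.range ∧ ∀ a, g' (diagEmbedding m d a) = f a := by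
  obtain ⟨ψ, hψ⟩ := exists_factor hg hfg
  obtain ⟨U, hU⟩ := exists_unitary_conj_diagEmbedding hd ψ
  -- Precomposing `g` with an inner automorphism absorbs the unitary without changing the range.
  let e := Unitary.conjStarAlgAut ℂ _ U
  refine ⟨g.comp e.toStarAlgHom, hg.comp e.injective, le_antisymm ?_ ?_, fun a => ?_⟩
  · rintro _ ⟨x, rfl⟩
    exact ⟨e x, rfl⟩
  · rintro _ ⟨x, rfl⟩
    exact ⟨e.symm x, congrArg g (e.apply_symm_apply x)⟩
  · rw [← hψ a, hU a]
    rfl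

end Factor

/-! ### Classification of the limits of full matrix algebras -/

section Classification

lemma boxProd_surjective {D : ℕ → ℕ} (h0 : D 0 = 1) (hdvd : ∀ k, D k ∣ D (k + 1))
    (hlt : ∀ k, D k < D (k + 1)) : ∃ β : ℕ → ℕ+, ∀ k, boxProd β k = D k := by
  choose c hc using hdvd
  have hc1 : ∀ k, 1 < c k := fun k => by
    have h1 := hlt k
    rw [hc k] at h1
    exact not_le.1 fun h => (Nat.mul_le_mul_left (D k) h).not_gt (by rwa [mul_one])
  -- The ratios are at least `2`, so lowering them by one gives positive integers, as the factors `β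
  -- k + 1` require.
  refine ⟨fun k => ⟨c k - 1, Nat.sub_pos_of_lt (hc1 k)⟩, fun k => ?_⟩
  induction k with
  | zero => exact h0.symm
  | succ k ih =>
    change (c k - 1 + 1) * boxProd _ k = _
    rw [ih, hc k, mul_comm, Nat.sub_add_cancel (hc1 k).le]

/-- The jumps of a nondecreasing unbounded sequence enumerate its values. -/
lemma exists_jumps {d : ℕ → ℕ} (hmono : Monotone d) (hunb : ∀ N, ∃ n, N ≤ n ∧ d n ≠ d N) :
    ∃ j : ℕ → ℕ, j 0 = 0 ∧ StrictMono j ∧ (∀ k, d (j k) < d (j (k + 1))) ∧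
      ∀ n, ∃ k, j k ≤ n ∧ d (j k) = d n := by
  classical
  -- The index `0` is declared a jump by hand: truncated subtraction makes the strict inequality
  -- fail there.
  let p : ℕ → Prop := fun n => n = 0 ∨ d (n - 1) < d n
  have hinf : {n | p n}.Infinite := by
    intro hfin
    obtain ⟨N, hN⟩ := hfin.bddAbove
    have hconst : ∀ n, N ≤ n → d n = d N := fun n hn => by
      induction n, hn using Nat.le_induction with
      | base => rfl
      | succ n hn ih =>
        rw [← ih]
        refine le_antisymm (not_lt.1 fun hlt => ?_) (hmono n.le_succ)
        have := hN (show p (n + 1) from Or.inr hlt)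
        omega
    obtain ⟨n, hn, hne⟩ := hunb N
    exact hne (hconst n hn)
  have hj := Nat.nth_strictMono (p := p) hinf
  refine ⟨Nat.nth p, ?_, hj, fun k => ?_, fun n => ?_⟩
  · have h0 : p 0 := Or.inl rfl
    have h := Nat.nth_count h0
    rwa [Nat.count_zero] at h
  · have h1 : Nat.nth p k < Nat.nth p (k + 1) := hj k.lt_succ_self
    rcases Nat.nth_mem_of_infinite (p := p) hinf (k + 1) with h | h
    · omega
    · exact (hmono (Nat.le_sub_one_of_lt h1)).trans_lt h
  · induction n with
    | zero => exact ⟨Nat.count p 0, (Nat.nth_count (p := p) (Or.inl rfl)).le,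
        by rw [Nat.nth_count (p := p) (Or.inl rfl)]⟩
    | succ n ih =>
      by_cases h : p (n + 1)
      · exact ⟨Nat.count p (n + 1), (Nat.nth_count h).le, by rw [Nat.nth_count h]⟩
      · obtain ⟨k, hk, hdk⟩ := ih
        refine ⟨k, hk.trans n.le_succ, hdk.trans (le_antisymm (hmono n.le_succ) ?_)⟩
        exact not_lt.1 fun hlt => h (Or.inr hlt)

variable {A : Type} [CStarAlgebra A]

/-- A strictly increasing sequence of matrix subalgebras with dense union is, up to isomorphism,
the sequence of stages of a UHF algebra. -/
lemma exists_equiv_uhfAlgebra {R : ℕ → StarSubalgebra ℂ A} {D : ℕ → ℕ} (hR : Monotone R)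
    (hdense : Dense (⋃ k, (R k : Set A))) (h0 : D 0 = 1) (hlt : ∀ k, D k < D (k + 1))
    (g : ∀ k, Matrix (Fin (D k)) (Fin (D k)) ℂ →⋆ₐ[ℂ] A) (hg : ∀ k, Function.Injective (g k))
    (hgR : ∀ k, (g k).range = R k) :
    ∃ (β : ℕ → ℕ+) (π : uhfAlgebra β ≃⋆ₐ[ℂ] A), (∀ k, boxProd β k = D k) ∧
      ∀ k, (uhfStage β k).map π.toStarAlgHom = R k := by
  have hpos : ∀ k, 0 < D k := fun k => by
    cases k with
    | zero => rw [h0]; exact one_pos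
    | succ k => exact (Nat.zero_le _).trans_lt (hlt k)
  have hle : ∀ k, (g k).range ≤ (g (k + 1)).range := fun k => by
    rw [hgR, hgR]
    exact hR k.le_succ
  obtain ⟨β, hβ⟩ := boxProd_surjective h0 (fun k => by
    obtain ⟨ψ, -⟩ := exists_factor (hg (k + 1)) (hle k)
    exact dvd_of_starAlgHom ψ (hpos k)) hlt
  obtain rfl : boxProd β = D := funext hβ
  -- Candidates for the parametrization of the `k`-th subalgebra. The prescribed range is carried
  -- along so that each choice can be extended compatibly with the next diagonal embedding.
  let T : ℕ → Type := fun k =>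
    {f : (uhfSequence β).obj k →⋆ₐ[ℂ] A // Function.Injective f ∧ f.range = R k}
  have step : ∀ k (f : T k), ∃ f' : T (k + 1), ∀ a, f'.1 ((uhfSequence β).map k a) = f.1 a := by
    rintro k ⟨f, -, hf⟩
    obtain ⟨g', h1, h2, h3⟩ := exists_extension_diagEmbedding (m := β k + 1) (hpos k) (f := f)
      (g := g (k + 1)) (hg (k + 1)) (hf.le.trans ((hR k.le_succ).trans (hgR _).ge))
    exact ⟨⟨g', h1, h2.trans (hgR _)⟩, h3⟩
  choose next hnext using step
  let F : ∀ k, T k := fun k => Nat.rec ⟨g 0, hg 0, hgR 0⟩ next k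
  obtain ⟨Φ, hΦ⟩ := CStarInductiveSequence.Limit.exists_lift (fun k => (F k).1)
    fun k a => hnext k (F k) a
  have hlim := (uhfSequence β).isCStarInductiveLimit
  have hcont : Continuous Φ := AddMonoidHomClass.continuous_of_bound Φ 1 fun x => by
    rw [one_mul]; exact NonUnitalStarAlgHom.norm_apply_le Φ x
  have hnorm : ∀ x, ‖Φ x‖ = ‖x‖ := hlim.induction (isClosed_eq (by fun_prop) (by fun_prop))
    fun n a => by
      rw [hΦ, NonUnitalStarAlgHom.norm_map _ (F n).2.1,
        NonUnitalStarAlgHom.norm_map _ (hlim.injective n)]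
  have hiso : Isometry Φ := AddMonoidHomClass.isometry_of_norm Φ hnorm
  have hmap : ∀ k, (uhfStage β k).map Φ = R k := fun k => by
    rw [← (F k).2.2]
    refine le_antisymm ?_ ?_
    · rintro _ ⟨_, ⟨a, rfl⟩, rfl⟩
      exact ⟨a, (hΦ k a).symm⟩
    · rintro _ ⟨a, rfl⟩
      exact ⟨_, ⟨a, rfl⟩, hΦ k a⟩
  -- An isometry on a complete space has closed range, and this range contains the dense union.
  have hsurj : Function.Surjective Φ := by
    have hclosed := hiso.isClosedEmbedding.isClosed_range
    have hsub : (⋃ k, (R k : Set A)) ⊆ Set.range Φ := by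
      refine Set.iUnion_subset fun k x hx => ?_
      rw [← hmap k] at hx
      obtain ⟨y, -, rfl⟩ := hx
      exact ⟨y, rfl⟩
    exact fun x => hclosed.closure_subset_iff.2 hsub (hdense x)
  exact ⟨β, StarAlgEquiv.ofBijective Φ ⟨hiso.injective, hsurj⟩, fun _ => rfl, hmap⟩

/-- The Lip-norm depends only on the set of stages and their dimensions, so a sequence with
repetitions may be thinned to the indices where the dimension jumps. -/
theorem exists_isometricallyIsomorphic_uhf {k : ℝ} {X : LipPair} (hX : UHFClass k X) :
    ∃ β, IsometricallyIsomorphic (uhf β (dimWeight k β)) X := by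
  obtain ⟨hinfin, I, ι, μ, hmat, h0, hlim, hμ, hf, hL⟩ := hX
  choose d he using hmat
  have e := fun n => (he n).some
  have hrank : ∀ n, Module.finrank ℂ (I.obj n) = d n ^ 2 := fun n => by
    rw [LinearEquiv.finrank_eq (e n).toAlgEquiv.toLinearEquiv, Module.finrank_matrix]
    simp [pow_two]
  have hfin : ∀ n, FiniteDimensional ℂ (I.obj n) := fun n =>
    LinearEquiv.finiteDimensional (e n).toAlgEquiv.toLinearEquiv.symm
  have hfil := hlim.isTracialFiltration hfin h0 hμ hf
  let g : ∀ n, Matrix (Fin (d n)) (Fin (d n)) ℂ →⋆ₐ[ℂ] X.carrier := fun n =>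
    (ι n).comp (e n).symm.toStarAlgHom
  have hg : ∀ n, Function.Injective (g n) := fun n =>
    (hlim.injective n).comp (e n).symm.injective
  have hgR : ∀ n, (g n).range = (ι n).range := fun n => by
    refine le_antisymm ?_ ?_
    · rintro _ ⟨x, rfl⟩
      exact ⟨(e n).symm x, rfl⟩
    · rintro _ ⟨x, rfl⟩
      exact ⟨e n x, congrArg (ι n) ((e n).symm_apply_apply x)⟩
  have hd0 : d 0 = 1 := by
    have h := hrank 0
    rw [h0] at h
    exact (Nat.pow_eq_one.1 h.symm).resolve_right two_ne_zero
  have hmono : Monotone d := monotone_nat_of_le_succ fun n => by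
    have h := LinearMap.finrank_le_finrank_of_injective
      (f := (I.map n).toAlgHom.toLinearMap) (I.map_injective n)
    rw [hrank, hrank] at h
    exact (Nat.pow_le_pow_iff_left two_ne_zero).1 h
  have hRmono := hlim.range_mono
  -- Nested subspaces of equal finite dimension coincide.
  have hRd : ∀ {n m}, n ≤ m → d n = d m → (ι n).range = (ι m).range := fun {n m} hnm hdnm => by
    have hle : (ι n).range ≤ (ι m).range := hRmono hnm
    refine SetLike.coe_injective (congrArg (fun S : Submodule ℂ X.carrier => (S : Set X.carrier))
      (Submodule.eq_of_le_of_finrank_eq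
      (S₁ := LinearMap.range (ι n).toAlgHom.toLinearMap)
      (S₂ := LinearMap.range (ι m).toAlgHom.toLinearMap) hle ?_))
    rw [LinearMap.finrank_range_of_inj (hlim.injective n),
      LinearMap.finrank_range_of_inj (hlim.injective m), hrank, hrank, hdnm]
  -- Otherwise the stages become constant; their dense union would be one closed finite-dimensional
  -- stage, contradicting infinite dimension.
  have hunb : ∀ N, ∃ n, N ≤ n ∧ d n ≠ d N := by
    by_contra! hcon
    obtain ⟨N, hN⟩ := hcon
    have hclosed : IsClosed ((LinearMap.range (ι N).toAlgHom.toLinearMap :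
        Submodule ℂ X.carrier) : Set X.carrier) := Submodule.closed_of_finiteDimensional _
    have hsurj : Function.Surjective (ι N).toAlgHom.toLinearMap :=
      hlim.induction (p := fun x => x ∈ LinearMap.range (ι N).toAlgHom.toLinearMap) hclosed
        fun n a => by
        have h1 : ι n a ∈ (ι (max n N)).range := hRmono (le_max_left n N) ⟨a, rfl⟩
        rw [← hRd (le_max_right n N) (hN _ (le_max_right n N)).symm] at h1
        exact h1
    exact hinfin (Module.Finite.of_surjective _ hsurj)
  obtain ⟨j, hj0, hj, hjlt, hjall⟩ := exists_jumps hmono hunb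
  have hjall' : ∀ n, ∃ k, (ι n).range = (ι (j k)).range ∧ d n = d (j k) := fun n => by
    obtain ⟨k, hk, hdk⟩ := hjall n
    exact ⟨k, (hRd hk hdk).symm, hdk.symm⟩
  obtain ⟨β, π, hβ, hπ⟩ := exists_equiv_uhfAlgebra (R := fun k => (ι (j k)).range)
    (D := fun k => d (j k)) (fun _ _ h => hRmono (hj.monotone h))
    (by
      refine hlim.dense.mono (Set.iUnion_subset fun n => ?_)
      obtain ⟨k, hk, -⟩ := hjall' n
      refine Set.subset_iUnion_of_subset k ?_
      rw [← hk]
      exact subset_rfl)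
    (by rw [hj0, hd0]) hjlt (fun k => g (j k)) (fun k => hg _) (fun k => hgR _)
  refine ⟨β, π, fun (a : selfAdjoint (uhfAlgebra β)) => ?_⟩
  have hu := isTracialFiltration_uhf β
  have hπinj : Function.Injective π.toStarAlgHom := π.injective
  -- The faithful trace in the definition of the class is arbitrary, but uniqueness of the trace on
  -- the UHF algebra forces it to correspond to `uhfTrace`.
  have htrace : μ ∘ₗ π.toStarAlgHom.toAlgHom.toLinearMap = uhfTrace β :=
    eq_uhfTrace (hμ.comp π.toStarAlgHom)
  have hterm : ∀ m, ENNReal.ofReal (‖π a - condExp μ (ι (j m)).range (π a)‖ /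
      (Module.finrank ℂ (I.obj (j m)) : ℝ) ^ (-k)) =
      ENNReal.ofReal (‖(a : uhfAlgebra β) - condExp (uhfTrace β) (uhfStage β m) a‖ /
        dimWeight k β m) := fun m => by
    have := hu.finite m
    have := hfil.finite (j m)
    have h1 : condExp μ (ι (j m)).range (π a) = π (condExp (uhfTrace β) (uhfStage β m) a) :=
      condExp_map hu.tracial hu.faithful hμ hf (fun z => DFunLike.congr_fun htrace z) (hπ m) _
    rw [h1, ← map_sub, dimWeight, finrank_uhfSequence, hβ, hrank]
    congr 2
    exact NonUnitalStarAlgHom.norm_map π.toStarAlgHom hπinj _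
  rw [hL]
  -- The two suprema run over the same values: each original stage equals one of the retained
  -- stages, with the same weight.
  refine le_antisymm (iSup_le fun n => ?_) (iSup_le fun m => ?_)
  · obtain ⟨m, hm, hdm⟩ := hjall' n
    have hn : ENNReal.ofReal (‖π a - condExp μ (ι n).range (π a)‖ /
        (Module.finrank ℂ (I.obj n) : ℝ) ^ (-k)) =
        ENNReal.ofReal (‖π a - condExp μ (ι (j m)).range (π a)‖ /
          (Module.finrank ℂ (I.obj (j m)) : ℝ) ^ (-k)) := by
      rw [hm, hrank, hrank, hdm]
    exact (hn.trans (hterm m)).le.trans (le_iSup (fun m => ENNReal.ofReal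
      (‖(a : uhfAlgebra β) - condExp (uhfTrace β) (uhfStage β m) a‖ / dimWeight k β m)) m)
  · rw [← hterm m]
    exact le_iSup (fun n => ENNReal.ofReal (‖π a - condExp μ (ι n).range (π a)‖ /
      (Module.finrank ℂ (I.obj n) : ℝ) ^ (-k))) (j m)

end Classification

/-- One exponent `s` for the size handles both choices of weights. The class has index `s / 2`
because the dimension is the square of the size. -/
theorem isHolderSurjection_uhf {k s : ℝ} (hk : 0 < k) (hks : k ≤ s) :
    IsHolderSurjection 2 k (fun β => uhf β (sizeWeight s β)) (UHFClass (s / 2)) where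
  isQCMS := isQuasiLeibnizQCMS_uhf (hk.trans_le hks)
  mem := uhfClass_uhf s
  holder := propinquity_uhf_le_baireDist hk hks
  surjective X hX := by
    obtain ⟨β, hβ⟩ := exists_isometricallyIsomorphic_uhf hX
    rw [dimWeight_eq_sizeWeight, mul_div_cancel₀ s two_ne_zero] at hβ
    exact ⟨β, hβ⟩

end QuantumMetric

end

theorem mainTheorem2 (k : ℝ) (hk : 0 < k) :
    (∀ β : ℕ → ℕ+,
      (∃! μ : uhfAlgebra β →ₗ[ℂ] ℂ, IsTracialState μ) ∧
      IsTracialState (uhfTrace β) ∧ IsFaithful (uhfTrace β) ∧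
      ∀ n, ∃! E : uhfAlgebra β →L[ℂ] uhfAlgebra β,
        IsPreservingExpectation (uhfTrace β) (uhfStage β n) E) ∧
    IsHolderSurjection 2 k (fun β => uhf β (dimWeight k β)) (UHFClass k) ∧
    IsHolderSurjection 2 k (fun β => uhf β (sizeWeight k β)) (UHFClass (k / 2)) := by
  refine ⟨uhfAlgebra_trace_and_expectations, ?_, isHolderSurjection_uhf hk le_rfl⟩
  -- Weights by dimension to the power `-k` are weights by size to the power `-2 * k`.
  have h := isHolderSurjection_uhf (s := 2 * k) hk (by linarith)
  simpa only [← dimWeight_eq_sizeWeight, mul_div_cancel_left₀ k two_ne_zero] using h
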